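/- Let $d\ge 1$, let $\Lambda$ be a stationary random Borel measure on $\mathbb{R}^d$ with $\mathbb{E}[\Lambda([0,1]^d)]=1$, and for $\lambda>0$ let $X^\lambda$ be a Cox point process with random intensity measure $\lambda\Lambda$, i.e. conditioned on $\Lambda$, $X^\lambda$ is a Poisson point process with intensity measure $\lambda\Lambda$. Write $Q_s=[-s/2,s/2]^d$, and $\vartheta_x\mu(B)=\mu(B+x)$ for measures $\mu$. The Palm versions $\Lambda^*$ and $X^{\lambda,*}$ are the random measure and the point process with laws $$\mathbb{E}[f(\Lambda^*)]=\mathbb{E}\Big[\int_{Q_1}f(\vartheta_x\Lambda)\,\Lambda(\mathrm{d}x)\Big],\qquad \mathbb{E}[f(X^{\lambda,*})]=\frac1\lambda\,\mathbb{E}\Big[\sum_{X_i\in X^\lambda\cap Q_1}f(X^\lambda-X_i)\Big]$$ for bounded measurable $f\ge 0$. For $r>0$ let $\theta(\lambda,r)$ be the probability that the origin $o$ lies in an infinite connected component of the Gilbert graph $g_r(X^{\lambda,*})$, in which two points of $X^{\lambda,*}$ are joined by an edge if their distance is less than $r$. Let $\mathcal{R}_r$ be the family of all compact sets $A\subset\mathbb{R}^d$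 with $o\in A$ such that the set of points at distance at most $r/2$ from $A$ is connected, and let $\partial_rA=\{x\in\mathbb{R}^d:\operatorname{dist}(x,A)<r\}\setminus A$. **Theorem.** Let $r>0$. Then $$\liminf_{\lambda\uparrow\infty}\lambda^{-1}\log(1-\theta(\lambda,r))\ \ge\ -\inf_{A\in\mathcal{R}_r}\operatorname{ess\,inf}\Lambda^*(\partial_rA).$$ If, additionally, $d\ge 2$, $\Lambda$ is $b$-dependent for some $b\ge0$ (that is, the restrictions of $\Lambda$ to Borel sets $A$ and $B$ are independent whenever $\operatorname{dist}(A,B)>b$), and $\operatorname{ess\,inf}\Lambda(Q_\delta)>0$ for every $\delta>0$, then the limit on the right-hand side below exists in $[0,\infty]$ and $$\limsup_{\lambda\uparrow\infty}\lambda^{-1}\log(1-\theta(\lambda,r))\ \le\ -\lim_{\varepsilon\downarrow0}\ \inf_{A\in\mathcal{R}_{r+\varepsilon}}\operatorname{ess\,inf}\Lambda^*(\partial_{r-\varepsilon}A).$$ -/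

import Mathlib

open MeasureTheory ProbabilityTheory Filter Topology
open scoped ENNReal NNReal

noncomputable section

namespace CoxPerc

/-- The Euclidean space `ℝ^d`. -/
abbrev Space (d : ℕ) : Type := EuclideanSpace ℝ (Fin d)

/-- The closed cube `Q_s(x) = x + [-s/2, s/2]^d`. -/
def cube {d : ℕ} (s : ℝ) (x : Space d) : Set (Space d) :=
  {y | ∀ i, |y i - x i| ≤ s / 2}

/-- The unit cube `[0,1]^d`. -/
def unitCube (d : ℕ) : Set (Space d) :=
  {y | ∀ i, 0 ≤ y i ∧ y i ≤ 1}

/-- The translation `ϑ_x μ`, that is `(ϑ_x μ)(A) = μ(A + x)`.  A counting measure with points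
`X_j` is sent to the counting measure with points `X_j - x`. -/
def shift {d : ℕ} (x : Space d) (μ : Measure (Space d)) : Measure (Space d) :=
  μ.map (fun y => y - x)

/-- A random measure (on the probability space `(Ω, P)`) is stationary if its law, on the space of
Borel measures with the evaluation `σ`-algebra, is invariant under all translations. -/
def IsStationary {d : ℕ} {Ω : Type*} [MeasurableSpace Ω] (P : Measure Ω)
    (M : Ω → Measure (Space d)) : Prop :=
  ∀ x : Space d, P.map (fun ω => shift x (M ω)) = P.map M

/-- `b`-dependence: the restrictions of the random measure to Borel sets `A` and `B` are
independent whenever `dist(A, B) = inf {|x - y| : x ∈ A, y ∈ B} > b`. -/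
def IsBDependent {d : ℕ} {Ω : Type*} [MeasurableSpace Ω] (P : Measure Ω)
    (M : Ω → Measure (Space d)) (b : ℝ≥0) : Prop :=
  ∀ A B : Set (Space d), MeasurableSet A → MeasurableSet B →
    (b : ℝ≥0∞) < (⨅ x ∈ A, ⨅ y ∈ B, edist x y) →
    IndepFun (fun ω => (M ω).restrict A) (fun ω => (M ω).restrict B) P

/-- The Poisson distribution on `{0, 1, 2, …} ∪ {∞}` with parameter `t ∈ [0, ∞]`; for `t = ∞` it
is the unit mass at `∞`. -/
def poissonLaw (t : ℝ≥0∞) : Measure ℝ≥0∞ :=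
  if t = ∞ then Measure.dirac ∞
  else (poissonMeasure t.toNNReal).map (fun n : ℕ => (n : ℝ≥0∞))

/-- `Q` is the law of a Poisson point process with intensity measure `μ`: it is concentrated on
counting measures, the number of points in a Borel set `B` is Poisson distributed with parameter
`μ(B)`, and the numbers of points in pairwise disjoint Borel sets are independent. -/
structure IsPoissonProcess {d : ℕ} (μ : Measure (Space d)) (Q : Measure (Measure (Space d))) :
    Prop where
  isProbabilityMeasure : IsProbabilityMeasure Q
  counting : ∀ᵐ N ∂Q, ∀ B : Set (Space d), MeasurableSet B → ∃ n : ℕ∞, N B = (n : ℝ≥0∞)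
  map_count : ∀ B : Set (Space d), MeasurableSet B → Q.map (fun N => N B) = poissonLaw (μ B)
  indep : ∀ (n : ℕ) (B : Fin n → Set (Space d)), (∀ i, MeasurableSet (B i)) →
    Pairwise (fun i j => Disjoint (B i) (B j)) →
    iIndepFun (fun i (N : Measure (Space d)) => N (B i)) Q

/-- `X` is a Cox point process with random intensity measure `M`: there is a regular conditional
law `κ` of `X` given `M`, and conditioned on `M` the process `X` is a Poisson point process with
intensity measure `M`. -/
structure IsCoxProcess {d : ℕ} {Ω : Type*} [MeasurableSpace Ω] (P : Measure Ω)
    (M X : Ω → Measure (Space d)) : Prop where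
  measurable : Measurable X
  conditional : ∃ κ : Kernel (Measure (Space d)) (Measure (Space d)), IsMarkovKernel κ ∧
    P.map (fun ω => (M ω, X ω)) = (P.map M) ⊗ₘ κ ∧
    ∀ᵐ μ ∂(P.map M), IsPoissonProcess μ (κ μ)

/-- The (unnormalized) Palm measure of a random measure `M`: the measure on the space of Borel
measures with `∫ f d(palm) = E [∫_{Q_1} f(ϑ_x M) M(dx)]`.  If `M` is a point process, then the
right-hand side is `E [∑_{X_i ∈ Q_1} f(M - X_i)]`. If `E [M(Q_1)] = 1`, this is the law of the
Palm version `M^*`. -/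
def palm {d : ℕ} {Ω : Type*} [MeasurableSpace Ω] (P : Measure Ω)
    (M : Ω → Measure (Space d)) : Measure (Measure (Space d)) :=
  P.bind (fun ω => ((M ω).restrict (cube 1 0)).map (fun x => shift x (M ω)))

/-- The set of points of a counting measure. -/
def points {d : ℕ} (N : Measure (Space d)) : Set (Space d) :=
  {x | N {x} ≠ 0}

/-- The Gilbert graph on the vertex set `V`: two distinct points are connected by an edge if their
distance is less than `r`. -/
def gilbertGraph {d : ℕ} (r : ℝ) (V : Set (Space d)) : SimpleGraph V where
  Adj x y := x ≠ y ∧ dist x y < r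
  symm := ⟨fun x y h => ⟨h.1.symm, by rw [dist_comm]; exact h.2⟩⟩
  loopless := ⟨fun _ h => h.1 rfl⟩

/-- The event `o ↭ ∞`: the origin is a point of `N` and its connected component in the Gilbert
graph on the points of `N` is infinite. -/
def OriginPercolates {d : ℕ} (r : ℝ) (N : Measure (Space d)) : Prop :=
  ∃ h : (0 : Space d) ∈ points N,
    ((gilbertGraph r (points N)).connectedComponentMk ⟨0, h⟩).supp.Infinite

/-- The percolation probability `P(o ↭ ∞ in g_r(X^*))`, where `X` is a stationary point process
with intensity `lam` (so `E [X(Q_1)] = lam`) and `X^*` is its Palm version, whose law is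
`lam⁻¹ • palm P X`. -/
def percProb {d : ℕ} {Ω : Type*} [MeasurableSpace Ω] (P : Measure Ω)
    (X : Ω → Measure (Space d)) (lam r : ℝ) : ℝ≥0∞ :=
  ((ENNReal.ofReal lam)⁻¹ • palm P X) {N | OriginPercolates r N}

/-- The family `R_r` of `r`-connected compact sets containing the origin: the points at distance
at most `r / 2` from `A` form a connected set. -/
def rConnected (d : ℕ) (r : ℝ) : Set (Set (Space d)) :=
  {A | IsCompact A ∧ 0 ∈ A ∧ IsConnected (Metric.cthickening (r / 2) A)}

/-- The `r`-boundary `∂_r A = {x : dist(x, A) < r} \ A`. -/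
def rBoundary {d : ℕ} (r : ℝ) (A : Set (Space d)) : Set (Space d) :=
  Metric.thickening r A \ A

/-- The quantity `inf_{A ∈ R_s} ess-inf Λ^*(∂_t A)` in `[0, ∞]`. -/
def isolationCost {d : ℕ} {Ω : Type*} [MeasurableSpace Ω] (P : Measure Ω)
    (Lam : Ω → Measure (Space d)) (s t : ℝ) : ℝ≥0∞ :=
  ⨅ A ∈ rConnected d s, essInf (fun μ : Measure (Space d) => μ (rBoundary t A)) (palm P Lam)

end CoxPerc

end

/-!
The void probabilities of the Palm version of the Cox process follow from the Mecke formula: for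
open `S` not containing the origin, `P(X^*(S) = 0) = E[exp(-λ Λ^*(S))]`.

For the lower bound, the origin cannot percolate if no point lies in `∂_r A`, where `A ∈ R_r`; by
the void formula this has probability `E[exp(-λ Λ^*(∂_r A))]`, whose exponential rate is
`-ess inf Λ^*(∂_r A)`.

For the upper bound, suppose that the cluster of the origin is finite and cover it by cubes of a
lattice with mesh small compared with `ε` and `r`. If the cluster stays in a large box, the union
`A` of these cubes is one of finitely many `r`-connected sets and `∂_{r-ε} A` contains no points.
Otherwise consider the sites whose cubes meet the `r/2`-neighbourhood of the cluster. The part of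
their outer boundary facing infinity is connected (Timár's argument, based on the vanishing of the
first cohomology modulo two of the lattice), so it contains a long path of empty cubes that starts
on a coordinate axis, at a distance at most its length from the origin. As each cube has mass
bounded away from zero, a union bound over such paths makes this second event negligible when the
box is large.
-/

noncomputable section

namespace CoxPerc

/-! ### Chains and the connectivity of visible boundaries -/

section Chains

variable {V : Type*} {adj : V → V → Prop} {S T C D : Set V}

/-- `x` and `y` are joined by a chain of points of `S`, consecutive ones being related by `adj`. -/
def ChainIn (adj : V → V → Prop) (S : Set V) : V → V → Prop :=
  Relation.ReflTransGen fun a b => adj a b ∧ a ∈ S ∧ b ∈ S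

/-- Connectivity of the set `S` with respect to the relation `adj`. -/
def ChainConnected (adj : V → V → Prop) (S : Set V) : Prop :=
  ∀ x ∈ S, ∀ y ∈ S, ChainIn adj S x y

namespace ChainIn

theorem symm [Std.Symm adj] {x y : V} (h : ChainIn adj S x y) : ChainIn adj S y x := by
  induction h with
  | refl => exact .refl
  | tail _ h ih => exact .head ⟨symm_of adj h.1, h.2.2, h.2.1⟩ ih

theorem mono (hST : S ⊆ T) {x y : V} (h : ChainIn adj S x y) : ChainIn adj T x y :=
  Relation.ReflTransGen.mono (fun _ _ h => ⟨h.1, hST h.2.1, hST h.2.2⟩) x y h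

theorem mem {x y : V} (h : ChainIn adj S x y) (hy : y ∈ S) : x ∈ S := by
  induction h using Relation.ReflTransGen.head_induction_on with
  | refl => exact hy
  | head h _ _ => exact h.2.1

theorem setOf_chainIn {x y : V} (h : ChainIn adj S x y) :
    ChainIn adj {z | ChainIn adj S z y} x y := by
  induction h using Relation.ReflTransGen.head_induction_on with
  | refl => exact .refl
  | head h h' ih => exact .head ⟨h.1, .head h h', h'⟩ ih

end ChainIn

theorem chainConnected_setOf_chainIn [Std.Symm adj] (S : Set V) (o : V) :
    ChainConnected adj {x | ChainIn adj S x o} := fun _ hx _ hy =>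
  hx.setOf_chainIn.trans (hy.setOf_chainIn.symm)

theorem abs_sub_le_walk_length {G : SimpleGraph V} {f : V → ℤ}
    (hf : ∀ a b, G.Adj a b → |f a - f b| ≤ 1) {a b : V} (q : G.Walk a b) :
    |f a - f b| ≤ q.length := by
  induction q with
  | nil => simp
  | cons h q ih =>
    have := hf _ _ h
    rw [SimpleGraph.Walk.length_cons]
    grind

theorem ChainIn.exists_injOn_path [Std.Refl adj] [Std.Symm adj] {u v : V}
    (h : ChainIn adj S u v) (hu : u ∈ S) {f : V → ℤ} (hf : ∀ a b, adj a b → |f a - f b| ≤ 1)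
    {m : ℕ} (hm : (m : ℤ) ≤ |f u - f v|) :
    ∃ p : ℕ → V, p 0 = u ∧ (∀ j, p j ∈ S) ∧ (∀ j, adj (p j) (p (j + 1))) ∧
      Set.InjOn p (Set.Iic m) := by
  let G : SimpleGraph V := .fromRel fun a b => adj a b ∧ a ∈ S ∧ b ∈ S
  have adj_of_G : ∀ {a b}, G.Adj a b → adj a b ∧ b ∈ S := by
    rintro a b ⟨-, h | h⟩
    · exact ⟨h.1, h.2.2⟩
    · exact ⟨symm_of adj h.1, h.2.1⟩
  have reachable : G.Reachable u v := by
    clear hm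
    induction h with
    | refl => exact .refl _
    | @tail b c _ hbc ih =>
      rcases eq_or_ne b c with rfl | hne
      · exact ih
      · exact ih.trans (SimpleGraph.Adj.reachable ⟨hne, .inl hbc⟩)
  obtain ⟨w, hw⟩ := reachable.exists_isPath
  have hlen : m ≤ w.length := by
    exact_mod_cast hm.trans (abs_sub_le_walk_length (fun a b h => hf a b (adj_of_G h).1) w)
  have step : ∀ j, w.getVert (j + 1) = w.getVert j ∨ G.Adj (w.getVert j) (w.getVert (j + 1)) := by
    intro j
    rcases lt_or_ge j w.length with hj | hj
    · exact .inr (w.adj_getVert_succ hj)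
    · exact .inl (by rw [w.getVert_of_length_le hj, w.getVert_of_length_le (by omega)])
  refine ⟨w.getVert, w.getVert_zero, fun j => ?_, fun j => ?_,
    hw.getVert_injOn.mono fun j hj => le_trans hj hlen⟩
  · induction j with
    | zero => simpa using hu
    | succ j ih =>
      rcases step j with h | h
      · exact h ▸ ih
      · exact (adj_of_G h).2
  · rcases step j with h | h
    · exact h ▸ refl_of adj _
    · exact (adj_of_G h).1

/-- The closed cochains: `ω` sums to zero, modulo two, over the edges of each triangle. -/
def TriangleClosed (adj : V → V → Prop) (ω : V → V → ZMod 2) : Prop :=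
  ∀ x y z, adj x y → adj y z → adj x z → ω x y + ω y z + ω x z = 0

/-- Vanishing of the first cohomology group modulo two: closed cochains have a potential. -/
def TriangleExact (adj : V → V → Prop) : Prop :=
  ∀ ω : V → V → ZMod 2, TriangleClosed adj ω →
    ∃ f : V → ZMod 2, ∀ x y, adj x y → f x + f y = ω x y

/-- The sites of `D` that are neighbours of `C`. -/
def visibleBoundary (adj : V → V → Prop) (C D : Set V) : Set V :=
  {v | v ∈ D ∧ ∃ c ∈ C, adj c v}

open Classical in
/-- The cochain that is one on the edges between `C` and `D`, and zero on all others. -/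
def cutCochain (C D : Set V) (x y : V) : ZMod 2 :=
  if (x ∈ C ∧ y ∈ D) ∨ (y ∈ C ∧ x ∈ D) then 1 else 0

theorem triangleClosed_cutCochain [Std.Symm adj] (hCD : Disjoint C D)
    (hthird : ∀ c ∈ C, ∀ w ∈ D, ∀ o, adj c o → adj w o → o ∈ C ∨ o ∈ D) :
    TriangleClosed adj (cutCochain C D) := by
  intro x y z hxy hyz hxz
  have disj : ∀ v, v ∈ C → v ∉ D := fun v hv => Set.disjoint_left.mp hCD hv
  have := symm_of adj hxy
  have := symm_of adj hyz
  have := symm_of adj hxz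
  have : (1 : ZMod 2) + 1 = 0 := by decide
  unfold cutCochain
  grind

theorem eq_of_chainIn_of_cutCochain {f : V → ZMod 2}
    (hf : ∀ x y, adj x y → f x + f y = cutCochain C D x y)
    (hS : Disjoint S C ∨ Disjoint S D) {a b : V} (hab : ChainIn adj S a b) : f a = f b := by
  induction hab with
  | refl => rfl
  | @tail b c _ h ih =>
    have hcut : cutCochain C D b c = 0 := if_neg (by grind)
    exact ih.trans (CharTwo.add_eq_zero.mp ((hf b c h.1).trans hcut))

/-- Timár's argument: if the visible boundary had a proper component `W`, the edges from `C` to `W`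
would form a closed cochain. Its potential is constant on `C` and on `D`, so it cannot change along
some of the edges from `C` to `D` only. -/
theorem ChainConnected.visibleBoundary [Std.Symm adj] (hexact : TriangleExact adj)
    (hC : ChainConnected adj C) (hD : ChainConnected adj D) (hCD : Disjoint C D)
    (hcl : ∀ x ∈ D, ∀ y, y ∉ C → adj x y → y ∈ D) :
    ChainConnected adj (visibleBoundary adj C D) := by
  intro u hu v hv
  by_contra huv
  set B := CoxPerc.visibleBoundary adj C D
  let W : Set V := {w | w ∈ B ∧ ChainIn adj B u w}
  have hCW : Disjoint C W := hCD.mono_right fun w hw => hw.1.1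
  have hclosed : TriangleClosed adj (cutCochain C W) := by
    refine triangleClosed_cutCochain hCW fun c hc w hw o hco hwo =>
      or_iff_not_imp_left.mpr fun ho => ?_
    have hoB : o ∈ B := ⟨hcl w hw.1.1 o ho hwo, c, hc, hco⟩
    exact ⟨hoB, hw.2.tail ⟨hwo, hw.1, hoB⟩⟩
  obtain ⟨f, hf⟩ := hexact _ hclosed
  obtain ⟨huD, c₁, hc₁, h₁⟩ := id hu
  obtain ⟨hvD, c₂, hc₂, h₂⟩ := id hv
  have hfC : f c₁ = f c₂ := eq_of_chainIn_of_cutCochain hf (.inr hCW) (hC _ hc₁ _ hc₂)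
  have hfD : f u = f v := eq_of_chainIn_of_cutCochain hf (.inl hCD.symm) (hD _ huD _ hvD)
  have hu1 : f c₁ + f u = 1 := (hf _ _ h₁).trans (if_pos (.inl ⟨hc₁, hu, .refl⟩))
  have hv0 : f c₂ + f v = 0 := (hf _ _ h₂).trans (if_neg (by
    rintro (h | h)
    · exact huv h.2.2
    · exact Set.disjoint_left.mp hCD h.1 hvD))
  exact zero_ne_one (hv0.symm.trans (hfC ▸ hfD ▸ hu1))

/-- The square with vertices `x`, `y`, `c y`, `c x` is filled by four triangles with apex `w`. -/
theorem TriangleClosed.add_map_eq {ω : V → V → ZMod 2} (hω : TriangleClosed adj ω) {c : V → V}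
    (hself : ∀ x, adj x (c x)) (hmap : ∀ x y, adj x y → adj (c x) (c y))
    (hcommon : ∀ x y, adj x y → ∃ w, adj w x ∧ adj w y ∧ adj w (c x) ∧ adj w (c y))
    {x y : V} (h : adj x y) : ω x y + ω (c x) (c y) = ω x (c x) + ω y (c y) := by
  obtain ⟨w, hx, hy, hcx, hcy⟩ := hcommon x y h
  have e1 := hω w x y hx h hy
  have e2 := hω w (c x) (c y) hcx (hmap x y h) hcy
  have e3 := hω w x (c x) hx (hself x) hcx
  have e4 := hω w y (c y) hy (hself y) hcy
  grind

theorem triangleExact_of_contraction [Std.Refl adj] {c : V → V} {o : V} (ho : c o = o)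
    (hself : ∀ x, adj x (c x)) (hmap : ∀ x y, adj x y → adj (c x) (c y))
    (hcommon : ∀ x y, adj x y → ∃ w, adj w x ∧ adj w y ∧ adj w (c x) ∧ adj w (c y))
    (hreach : ∀ x, ∃ n, c^[n] x = o) : TriangleExact adj := by
  intro ω hω
  have hoo : ω o o = 0 := by
    simpa [CharTwo.add_self_eq_zero] using hω o o o (refl_of adj o) (refl_of adj o) (refl_of adj o)
  let f (n : ℕ) (x : V) : ZMod 2 := ∑ k ∈ Finset.range n, ω (c^[k] x) (c^[k + 1] x)
  have telescope : ∀ (n : ℕ) {x y}, adj x y → f n x + f n y = ω x y + ω (c^[n] x) (c^[n] y) := by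
    intro n
    induction n with
    | zero => intro x y _; simp [f, CharTwo.add_self_eq_zero]
    | succ n ih =>
      intro x y h
      have hstep := hω.add_map_eq hself hmap hcommon h
      have hsucc : ∀ x, f (n + 1) x = f n (c x) + ω x (c x) := fun x => Finset.sum_range_succ' _ n
      rw [hsucc, hsucc, Function.iterate_succ_apply, Function.iterate_succ_apply]
      grind [ih (hmap x y h)]
  have iterate_eq : ∀ {x n m}, c^[n] x = o → n ≤ m → c^[m] x = o := fun {x n m} hn hnm => by
    rw [← Nat.sub_add_cancel hnm, Function.iterate_add_apply, hn, Function.iterate_fixed ho]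
  choose N hN using hreach
  have stable : ∀ x n, N x ≤ n → f n x = f (N x) x := fun x n hn =>
    (Finset.sum_subset (Finset.range_mono hn) fun k _ hk => by
      have hk : N x ≤ k := by simpa using hk
      rw [iterate_eq (hN x) hk, iterate_eq (hN x) (hk.trans k.le_succ), hoo]).symm
  refine ⟨fun x => f (N x) x, fun x y h => ?_⟩
  beta_reduce
  rw [← stable x _ (le_max_left (N x) (N y)), ← stable y _ (le_max_right (N x) (N y)),
    telescope _ h, iterate_eq (hN x) (le_max_left _ _), iterate_eq (hN y) (le_max_right _ _), hoo,
    add_zero]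

end Chains

/-! ### The lattice with nearest and diagonal neighbours -/

section Lattice

variable {ι : Type*}

/-- Adjacency of sites at sup-distance at most one (the king moves of chess); every site is adjacent
to itself. -/
def KingAdj (x y : ι → ℤ) : Prop := ∀ i, |x i - y i| ≤ 1

instance : Std.Symm (KingAdj (ι := ι)) := ⟨fun x y h i => abs_sub_comm (x i) (y i) ▸ h i⟩

instance : Std.Refl (KingAdj (ι := ι)) := ⟨fun _ _ => by simp⟩

/-- The king move from `x` towards `y`. -/
def stepTo (y x : ι → ℤ) : ι → ℤ := fun i => x i - (x i - y i).sign

theorem stepTo_cases (y x : ι → ℤ) (i : ι) :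
    (y i < x i ∧ stepTo y x i = x i - 1) ∨ (x i = y i ∧ stepTo y x i = y i) ∨
      (x i < y i ∧ stepTo y x i = x i + 1) := by
  rcases lt_trichotomy (x i - y i) 0 with h | h | h
  · exact .inr (.inr ⟨by omega, by simp [stepTo, Int.sign_eq_neg_one_of_neg h]⟩)
  · exact .inr (.inl ⟨by omega, by simp only [stepTo, h, Int.sign_zero, sub_zero]; omega⟩)
  · exact .inl ⟨by omega, by simp [stepTo, Int.sign_eq_one_of_pos h]⟩

theorem kingAdj_stepTo (y x : ι → ℤ) : KingAdj x (stepTo y x) := fun i => by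
  grind [stepTo_cases y x i]

theorem KingAdj.stepTo {x x' : ι → ℤ} (h : KingAdj x x') (y : ι → ℤ) :
    KingAdj (stepTo y x) (stepTo y x') := fun i => by
  grind [h i, stepTo_cases y x i, stepTo_cases y x' i]

theorem KingAdj.exists_common_neighbour_stepTo {x x' : ι → ℤ} (h : KingAdj x x') (y : ι → ℤ) :
    ∃ w, KingAdj w x ∧ KingAdj w x' ∧ KingAdj w (CoxPerc.stepTo y x) ∧
      KingAdj w (CoxPerc.stepTo y x') := by
  have hcoord : ∀ i, ∃ w : ℤ, |w - x i| ≤ 1 ∧ |w - x' i| ≤ 1 ∧ |w - CoxPerc.stepTo y x i| ≤ 1 ∧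
      |w - CoxPerc.stepTo y x' i| ≤ 1 := by
    intro i
    have := h i
    have := stepTo_cases y x i
    have := stepTo_cases y x' i
    by_cases hc : y i < x i ∨ y i < x' i
    · exact ⟨max (x i) (x' i) - 1, by grind⟩
    · exact ⟨min (x i) (x' i) + if x i = y i ∧ x' i = y i then 0 else 1, by grind⟩
  choose w hw using hcoord
  exact ⟨w, fun i => (hw i).1, fun i => (hw i).2.1, fun i => (hw i).2.2.1, fun i => (hw i).2.2.2⟩

theorem iterate_stepTo (y : ι → ℤ) (n : ℕ) {x : ι → ℤ} (hx : ∀ i, |x i - y i| ≤ n) :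
    (stepTo y)^[n] x = y := by
  induction n generalizing x with
  | zero => exact funext fun i => by simpa [sub_eq_zero] using hx i
  | succ n ih =>
    rw [Function.iterate_succ_apply]
    exact ih fun i => by grind [hx i, stepTo_cases y x i]

theorem exists_iterate_stepTo_eq [Finite ι] (y x : ι → ℤ) : ∃ n, (stepTo y)^[n] x = y := by
  obtain ⟨n, hn⟩ := (Set.finite_range fun i => (x i - y i).natAbs).bddAbove
  refine ⟨n, iterate_stepTo y n fun i => ?_⟩
  rw [Int.abs_eq_natAbs]
  exact_mod_cast hn ⟨i, rfl⟩

theorem triangleExact_kingAdj [Finite ι] : TriangleExact (KingAdj (ι := ι)) :=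
  triangleExact_of_contraction (o := 0) (c := stepTo 0) (by ext; simp [stepTo]) (kingAdj_stepTo 0)
    (fun _ _ h => h.stepTo 0) (fun _ _ h => h.exists_common_neighbour_stepTo 0)
    (exists_iterate_stepTo_eq 0)

theorem chainIn_kingAdj_uIcc [Finite ι] (x y : ι → ℤ) : ChainIn KingAdj (Set.uIcc x y) x y := by
  obtain ⟨n, hn⟩ := exists_iterate_stepTo_eq y x
  induction n generalizing x with
  | zero => exact hn ▸ .refl
  | succ n ih =>
    have hmem : stepTo y x ∈ Set.uIcc x y := by
      constructor <;> intro i <;> simp only [Pi.inf_apply, Pi.sup_apply] <;>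
        grind [stepTo_cases y x i]
    exact .head ⟨kingAdj_stepTo y x, Set.left_mem_uIcc, hmem⟩
      ((ih _ hn).mono (Set.uIcc_subset_uIcc_right hmem))

/-- In dimension at least two the complement of a box is connected: move to the diagonal with the
coordinate `i` fixed, then change this coordinate with another one fixed. -/
theorem chainIn_kingAdj_of_le_abs [Finite ι] [Nontrivial ι] (R : ℤ) {x : ι → ℤ} {i : ι}
    (hx : R ≤ |x i|) : ChainIn KingAdj {z | ∃ j, R ≤ |z j|} x (fun _ => R) := by
  classical
  obtain ⟨j, hj⟩ := exists_ne i
  let y : ι → ℤ := Function.update (fun _ => R) i (x i)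
  have hxy : Set.uIcc x y ⊆ {z | ∃ j, R ≤ |z j|} := fun z hz => ⟨i, by
    grind [hz.1 i, hz.2 i, Pi.inf_apply, Pi.sup_apply]⟩
  have hy : Set.uIcc y (fun _ => R) ⊆ {z | ∃ j, R ≤ |z j|} := fun z hz => ⟨j, by
    grind [hz.1 j, hz.2 j, Pi.inf_apply, Pi.sup_apply]⟩
  exact ((chainIn_kingAdj_uIcc x y).mono hxy).trans ((chainIn_kingAdj_uIcc y _).mono hy)

theorem exists_outer_component [Finite ι] [Nontrivial ι] {C : Set (ι → ℤ)} (hfin : C.Finite) :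
    ∃ D : Set (ι → ℤ), ChainConnected KingAdj D ∧ Disjoint C D ∧
      (∀ x ∈ D, ∀ y, y ∉ C → KingAdj x y → y ∈ D) ∧ ∃ R, ∀ z i, R ≤ |z i| → z ∈ D := by
  obtain ⟨m, hm⟩ : ∃ m : ι → ℤ, ∀ c ∈ C, |c| ≤ m :=
    (hfin.image fun c => |c|).bddAbove.imp fun m hm c hc => hm ⟨c, hc, rfl⟩
  obtain ⟨R, hR⟩ := (Set.finite_range m).bddAbove
  have hsub : {z : ι → ℤ | ∃ j, R + 1 ≤ |z j|} ⊆ Cᶜ := fun z ⟨j, hj⟩ hz => by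
    have h1 : |z j| ≤ m j := hm z hz j
    have h2 : m j ≤ R := hR ⟨j, rfl⟩
    omega
  set o : ι → ℤ := fun _ => R + 1
  have hoC : o ∈ Cᶜ := hsub ⟨Classical.arbitrary ι, le_abs_self _⟩
  have hDC : ∀ x, ChainIn KingAdj Cᶜ x o → x ∉ C := fun x hx => hx.mem hoC
  exact ⟨{x | ChainIn KingAdj Cᶜ x o}, chainConnected_setOf_chainIn _ _,
    Set.disjoint_left.mpr fun x hx hxD => hDC x hxD hx,
    fun x hx y hy hxy => .head ⟨symm_of KingAdj hxy, hy, hDC x hx⟩ hx,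
    R + 1, fun z i hz => (chainIn_kingAdj_of_le_abs _ hz).mono hsub⟩

section BoundaryPath

variable {C D : Set (ι → ℤ)}

theorem exists_add_single_mem_visibleBoundary [DecidableEq ι] (hCD : Disjoint C D)
    (hcl : ∀ x ∈ D, ∀ y, y ∉ C → KingAdj x y → y ∈ D) {R : ℤ} (hR : ∀ z i, R ≤ |z i| → z ∈ D)
    {c : ι → ℤ} (hc : c ∈ C) (i : ι) {s : ℤ} (hs : |s| = 1) :
    ∃ t : ℕ, c + Pi.single i (t * s) ∈ visibleBoundary KingAdj C D := by
  classical
  have hex : ∃ t : ℕ, c + Pi.single i (t * s) ∈ D := by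
    refine ⟨(|c i| + |R|).toNat, hR _ i ?_⟩
    rw [Pi.add_apply, Pi.single_eq_same, Int.toNat_of_nonneg (by positivity)]
    grind
  have hpos : Nat.find hex ≠ 0 := fun h0 => Set.disjoint_left.mp hCD hc (by
    simpa [h0] using Nat.find_spec hex)
  obtain ⟨t, ht⟩ := Nat.exists_eq_succ_of_ne_zero hpos
  have hadj : KingAdj (c + Pi.single i (t * s)) (c + Pi.single i ((t + 1 : ℕ) * s)) := fun j => by
    rcases eq_or_ne j i with rfl | hj
    · simp [add_mul, hs]
    · simp [hj]
  have hmem : c + Pi.single i ((t + 1 : ℕ) * s) ∈ D := by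
    simpa only [ht] using Nat.find_spec hex
  have hnot : c + Pi.single i (t * s) ∉ D := Nat.find_min hex (by omega)
  exact ⟨t + 1, hmem, _, by_contra fun h => hnot (hcl _ hmem _ h (symm_of KingAdj hadj)), hadj⟩

theorem exists_far_visibleBoundary (hCD : Disjoint C D)
    (hcl : ∀ x ∈ D, ∀ y, y ∉ C → KingAdj x y → y ∈ D) {R : ℤ} (hR : ∀ z i, R ≤ |z i| → z ∈ D)
    (h0 : 0 ∈ C) {z : ι → ℤ} (hz : z ∈ C) (i : ι) :
    ∃ v ∈ visibleBoundary KingAdj C D, ∃ w ∈ visibleBoundary KingAdj C D,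
      |z i| ≤ |v i - w i| := by
  classical
  obtain ⟨s, hs, hsz⟩ : ∃ s : ℤ, |s| = 1 ∧ |z i| = s * z i := by
    rcases abs_cases (z i) with h | h
    · exact ⟨1, by simp, by omega⟩
    · exact ⟨-1, by simp, by omega⟩
  obtain ⟨t, ht⟩ := exists_add_single_mem_visibleBoundary hCD hcl hR hz i hs
  obtain ⟨t', ht'⟩ :=
    exists_add_single_mem_visibleBoundary hCD hcl hR h0 i (s := -s) (by rwa [abs_neg])
  refine ⟨_, ht, _, ht', ?_⟩
  rcases (abs_eq zero_le_one).mp hs with rfl | rfl <;>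
    simp only [Pi.add_apply, Pi.single_eq_same, Pi.zero_apply, mul_one, mul_neg, zero_add] <;> grind

theorem exists_boundary_path [DecidableEq ι] [Finite ι] [Nontrivial ι] (hfin : C.Finite)
    (hC : ChainConnected KingAdj C) (h0 : 0 ∈ C) {n : ℕ} {z : ι → ℤ} (hz : z ∈ C) {i : ι}
    (hzn : 2 * (n : ℤ) ≤ |z i|) (i₀ : ι) :
    ∃ k, n ≤ k ∧ ∃ a ≤ k, ∃ p : ℕ → ι → ℤ, p 0 = Pi.single i₀ (a : ℤ) ∧
      (∀ j, p j ∉ C ∧ ∃ c ∈ C, KingAdj c (p j)) ∧ (∀ j, KingAdj (p j) (p (j + 1))) ∧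
      Set.InjOn p (Set.Iic k) := by
  obtain ⟨D, hD, hCD, hcl, R, hR⟩ := exists_outer_component hfin
  set B := visibleBoundary KingAdj C D
  have hB : ChainConnected KingAdj B := hC.visibleBoundary triangleExact_kingAdj hD hCD hcl
  obtain ⟨a, ha⟩ := exists_add_single_mem_visibleBoundary hCD hcl hR h0 i₀ (s := 1) (by simp)
  obtain ⟨b, hb⟩ := exists_add_single_mem_visibleBoundary hCD hcl hR h0 i₀ (s := -1) (by simp)
  rw [zero_add, mul_one] at ha
  rw [zero_add] at hb
  have hfar : ∃ v ∈ B, ∃ i, ((max n a : ℕ) : ℤ) ≤ |(Pi.single i₀ (a : ℤ) : ι → ℤ) i - v i| := by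
    rcases le_total n a with hna | hna
    · refine ⟨_, hb, i₀, ?_⟩
      rw [Nat.cast_max, Pi.single_eq_same, Pi.single_eq_same]
      grind
    · obtain ⟨v, hv, w, hw, hvw⟩ := exists_far_visibleBoundary hCD hcl hR h0 hz i
      rw [max_eq_left hna]
      rcases le_or_gt (n : ℤ) |(Pi.single i₀ (a : ℤ) : ι → ℤ) i - v i| with h | h
      · exact ⟨v, hv, i, h⟩
      · exact ⟨w, hw, i, by grind⟩
  obtain ⟨v, hv, i, hi⟩ := hfar
  obtain ⟨p, hp0, hpB, hpadj, hpinj⟩ :=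
    (hB _ ha v hv).exists_injOn_path ha (f := fun x => x i) (fun x y h => h i) hi
  exact ⟨max n a, le_max_left _ _, a, le_max_right _ _, p, hp0,
    fun j => ⟨Set.disjoint_right.mp hCD (hpB j).1, (hpB j).2⟩, hpadj, hpinj⟩

end BoundaryPath

end Lattice

/-! ### Locally finite measures and point measures -/

section LocallyFinite

theorem isSFiniteKernel_of_forall_lt_top {α β : Type*} [MeasurableSpace α] [MeasurableSpace β]
    (κ : Kernel α β) (h : ∀ a, κ a Set.univ < ∞) : IsSFiniteKernel κ := by
  have hm : Measurable fun a => κ a Set.univ := κ.measurable_coe .univ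
  let η : Kernel α β := ⟨fun a => (κ a Set.univ)⁻¹ • κ a, Measure.measurable_of_measurable_coe _
    fun B hB => hm.inv.mul (κ.measurable_coe hB)⟩
  have : IsFiniteKernel η := ⟨1, ENNReal.one_lt_top, fun a => ENNReal.inv_mul_le_one _⟩
  have hκ : η.withDensity (fun a _ => κ a Set.univ) = κ := by
    ext a B
    have hf : Measurable (Function.uncurry fun a (_ : β) => κ a Set.univ) := hm.comp measurable_fst
    rw [Kernel.withDensity_apply' _ hf, setLIntegral_const]
    change κ a Set.univ * ((κ a Set.univ)⁻¹ * κ a B) = κ a B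
    rcases eq_or_ne (κ a Set.univ) 0 with h0 | h0
    · rw [measure_mono_null (Set.subset_univ B) h0, mul_zero, mul_zero]
    · rw [← mul_assoc, ENNReal.mul_inv_cancel h0 (h a).ne, one_mul]
  rw [← hκ]
  exact Kernel.IsSFiniteKernel.withDensity η fun a _ => (h a).ne

variable {E : Type*} [TopologicalSpace E] [MeasurableSpace E]

theorem isLocallyFiniteMeasure_iff_compactExhaustion (K : CompactExhaustion E) {N : Measure E} :
    IsLocallyFiniteMeasure N ↔ ∀ n, N (K n) < ∞ := by
  refine ⟨fun _ n => (K.isCompact n).measure_lt_top, fun h => ⟨fun x => ?_⟩⟩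
  obtain ⟨n, hn⟩ := K.exists_mem_nhds x
  exact ⟨K n, hn, h n⟩

open Classical in
/-- The measure itself if it is locally finite, and zero otherwise. -/
def locFinPart (N : Measure E) : Measure E := if IsLocallyFiniteMeasure N then N else 0

theorem locFinPart_eq (N : Measure E) [h : IsLocallyFiniteMeasure N] : locFinPart N = N := if_pos h

instance (N : Measure E) : IsLocallyFiniteMeasure (locFinPart N) := by
  unfold locFinPart
  split_ifs with h
  exacts [h, inferInstance]

variable [T2Space E] [WeaklyLocallyCompactSpace E] [SigmaCompactSpace E] [OpensMeasurableSpace E]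

theorem measurableSet_isLocallyFiniteMeasure :
    MeasurableSet {N : Measure E | IsLocallyFiniteMeasure N} := by
  simp only [isLocallyFiniteMeasure_iff_compactExhaustion (CompactExhaustion.choice E),
    Set.ofPred_forall]
  exact .iInter fun n => measurableSet_lt
    (Measure.measurable_coe (CompactExhaustion.isCompact _ n).measurableSet) measurable_const

theorem measurable_locFinPart : Measurable (locFinPart : Measure E → Measure E) := by
  classical
  exact Measurable.ite measurableSet_isLocallyFiniteMeasure measurable_id measurable_const

/-- The identity as a kernel, with measures that are not locally finite replaced by zero in order to
make the kernel s-finite. -/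
def locFinKernel (E : Type*) [TopologicalSpace E] [MeasurableSpace E] [T2Space E]
    [WeaklyLocallyCompactSpace E] [SigmaCompactSpace E] [OpensMeasurableSpace E] :
    Kernel (Measure E) E :=
  ⟨locFinPart, measurable_locFinPart⟩

instance : IsSFiniteKernel (locFinKernel E) := by
  let K := CompactExhaustion.choice E
  have hK : ∀ n, MeasurableSet (disjointed K n) :=
    MeasurableSet.disjointed fun n => (K.isCompact n).measurableSet
  have hU : ⋃ n, disjointed K n = Set.univ := iUnion_disjointed.trans K.iUnion_eq
  have hsum : locFinKernel E = Kernel.sum fun n => (locFinKernel E).restrict (hK n) := by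
    ext1 N
    rw [← (locFinKernel E N).restrict_univ, ← hU,
      Measure.restrict_iUnion (disjoint_disjointed _) hK]
    rfl
  have (n : ℕ) : IsSFiniteKernel ((locFinKernel E).restrict (hK n)) :=
    isSFiniteKernel_of_forall_lt_top _ fun N => by
      rw [Kernel.restrict_apply' _ _ _ .univ, Set.univ_inter]
      exact (measure_mono (disjointed_subset _ n)).trans_lt
        ((K.isCompact n).measure_lt_top (μ := locFinPart N))
  rw [hsum]
  exact Kernel.isSFiniteKernel_sum

end LocallyFinite

/-! ### Palm measures -/

section Shift

variable {d : ℕ}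

theorem isBounded_cube (s : ℝ) (x : Space d) : Bornology.IsBounded (cube s x) := by
  refine (Metric.isBounded_closedBall (x := x) (r := √(∑ _i : Fin d, (s / 2) ^ 2))).subset
    fun y hy => ?_
  rw [Metric.mem_closedBall, EuclideanSpace.dist_eq]
  refine Real.sqrt_le_sqrt (Finset.sum_le_sum fun i _ => ?_)
  rw [Real.dist_eq, ← sq_abs, abs_abs]
  exact pow_le_pow_left₀ (abs_nonneg _) (hy i) 2

theorem measurableSet_cube (s : ℝ) (x : Space d) : MeasurableSet (cube s x) := by
  rw [cube, Set.ofPred_forall]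
  exact .iInter fun i => measurableSet_le (by fun_prop) measurable_const

theorem shift_apply (x : Space d) (N : Measure (Space d)) (B : Set (Space d)) :
    shift x N B = N {y | y - x ∈ B} :=
  (MeasurableEquiv.subRight x).map_apply B

instance (x : Space d) (N : Measure (Space d)) [IsLocallyFiniteMeasure N] :
    IsLocallyFiniteMeasure (shift x N) where
  finiteAtNhds y := by
    obtain ⟨s, hs, hNs⟩ := N.finiteAt_nhds (y + x)
    refine ⟨(· + x) ⁻¹' s, (continuous_add_const x).continuousAt hs, ?_⟩
    simpa [shift_apply] using hNs

theorem measurable_shift_locFinPart :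
    Measurable fun p : Measure (Space d) × Space d => shift p.2 (locFinPart p.1) := by
  refine Measure.measurable_of_measurable_coe _ fun B hB => ?_
  have hT : MeasurableSet {q : (Measure (Space d) × Space d) × Space d | q.2 - q.1.2 ∈ B} :=
    (measurable_snd.sub (measurable_snd.comp measurable_fst)) hB
  have := Kernel.measurable_kernel_prodMk_left
    (κ := Kernel.prodMkRight (Space d) (locFinKernel (Space d))) hT
  convert this using 2 with p
  rw [shift_apply]
  rfl

theorem measurable_shift (N : Measure (Space d)) [IsLocallyFiniteMeasure N] :
    Measurable fun x => shift x N := by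
  simpa only [Function.comp_def, locFinPart_eq] using
    measurable_shift_locFinPart.comp (measurable_prodMk_left (x := N))

end Shift

section Palm

variable {d : ℕ}

/-- The contribution of a deterministic measure to the Palm measure of a random measure. -/
def palmKernel (d : ℕ) : Kernel (Measure (Space d)) (Measure (Space d)) where
  toFun N := ((locFinPart N).restrict (cube 1 0)).map fun x => shift x (locFinPart N)
  measurable' := by
    refine Measure.measurable_of_measurable_coe _ fun T hT => ?_
    have hT' (N : Measure (Space d)) :=
      measurable_shift (locFinPart N) hT
    simp_rw [Measure.map_apply (measurable_shift _) hT, Measure.restrict_apply (hT' _)]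
    exact Kernel.measurable_kernel_prodMk_left (κ := locFinKernel (Space d))
      ((measurable_shift_locFinPart hT).inter (measurable_snd (measurableSet_cube 1 0)))

theorem lintegral_palmKernel (N : Measure (Space d)) [IsLocallyFiniteMeasure N]
    {f : Measure (Space d) → ℝ≥0∞} (hf : Measurable f) :
    ∫⁻ μ, f μ ∂palmKernel d N = ∫⁻ x in cube 1 0, f (shift x N) ∂N := by
  change ∫⁻ μ, f μ ∂((locFinPart N).restrict (cube 1 0)).map _ = _
  simp only [locFinPart_eq]
  exact lintegral_map hf (measurable_shift N)

variable {Ω : Type*} [MeasurableSpace Ω] {P : Measure Ω} {M : Ω → Measure (Space d)}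

theorem palm_eq_bind (hM : Measurable M) (h : ∀ᵐ ω ∂P, IsLocallyFiniteMeasure (M ω)) :
    palm P M = (P.map M).bind (palmKernel d) := by
  have hpalm : palm P M = P.bind fun ω => palmKernel d (M ω) := by
    refine Measure.bind_congr_right ?_
    filter_upwards [h] with ω _
    exact .symm (by simp only [palmKernel, Kernel.coe_mk, locFinPart_eq])
  rw [hpalm, Measure.bind, Measure.bind, Measure.map_map (palmKernel d).measurable hM]
  rfl

theorem lintegral_palm (hM : Measurable M) (h : ∀ᵐ ω ∂P, IsLocallyFiniteMeasure (M ω))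
    {f : Measure (Space d) → ℝ≥0∞} (hf : Measurable f) :
    ∫⁻ μ, f μ ∂palm P M = ∫⁻ ω, ∫⁻ x in cube 1 0, f (shift x (M ω)) ∂M ω ∂P := by
  rw [palm_eq_bind hM h, Measure.lintegral_bind (palmKernel d).aemeasurable hf.aemeasurable,
    lintegral_map hf.lintegral_kernel hM]
  refine lintegral_congr_ae ?_
  filter_upwards [h] with ω _
  exact lintegral_palmKernel (M ω) hf

theorem palm_univ (hM : Measurable M) (h : ∀ᵐ ω ∂P, IsLocallyFiniteMeasure (M ω)) :
    palm P M Set.univ = ∫⁻ ω, M ω (cube 1 0) ∂P := by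
  rw [← lintegral_one, lintegral_palm hM h measurable_const]
  simp

theorem ae_palm (hM : Measurable M) (h : ∀ᵐ ω ∂P, IsLocallyFiniteMeasure (M ω))
    {T : Set (Measure (Space d))} (hT : MeasurableSet T)
    (hMT : ∀ᵐ ω ∂P, ∀ᵐ x ∂M ω, shift x (M ω) ∈ T) : ∀ᵐ μ ∂palm P M, μ ∈ T := by
  change palm P M Tᶜ = 0
  rw [← lintegral_indicator_one hT.compl, lintegral_palm hM h (measurable_one.indicator hT.compl)]
  refine (lintegral_congr_ae ?_).trans lintegral_zero
  filter_upwards [hMT] with ω hω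
  refine (lintegral_congr_ae (ae_restrict_of_ae ?_)).trans lintegral_zero
  filter_upwards [hω] with x hx
  simp [hx]

end Palm

section PointMeasure

variable {d : ℕ} {N : Measure (Space d)}

/-- A locally finite sum of point masses of size at least one. Only countably many sets are tested,
so that this is a measurable condition on `N`. -/
structure IsPointMeasure (N : Measure (Space d)) : Prop where
  isLocallyFiniteMeasure : IsLocallyFiniteMeasure N
  eq_zero_or_one_le_of_basis :
    ∀ U ∈ TopologicalSpace.countableBasis (Space d), N U = 0 ∨ 1 ≤ N U

theorem measurableSet_isPointMeasure :
    MeasurableSet {N : Measure (Space d) | IsPointMeasure N} := by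
  have heq : {N : Measure (Space d) | IsPointMeasure N} = {N | IsLocallyFiniteMeasure N} ∩
      ⋂ U ∈ TopologicalSpace.countableBasis (Space d), {N | N U ∈ {0} ∪ Set.Ici 1} := by
    ext N
    simpa using ⟨fun h => ⟨h.1, h.2⟩, fun h => ⟨h.1, h.2⟩⟩
  rw [heq]
  refine measurableSet_isLocallyFiniteMeasure.inter
    (.biInter (TopologicalSpace.countable_countableBasis _) fun U hU => ?_)
  exact Measure.measurable_coe (TopologicalSpace.isOpen_of_mem_countableBasis hU).measurableSet
    ((measurableSet_singleton 0).union measurableSet_Ici)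

theorem IsPointMeasure.exists_mem_nhds_measure_eq_zero (h : IsPointMeasure N) {x : Space d}
    (hx : N {x} < 1) : ∃ U ∈ 𝓝 x, N U = 0 := by
  have := h.isLocallyFiniteMeasure
  obtain ⟨V, hxV, hV, hNV⟩ := Set.exists_isOpen_lt_of_lt {x} 1 hx
  obtain ⟨U, hU, hxU, hUV⟩ := (TopologicalSpace.isBasis_countableBasis _).exists_subset_of_mem_open
    (hxV rfl) hV
  exact ⟨U, (TopologicalSpace.isOpen_of_mem_countableBasis hU).mem_nhds hxU,
    (h.eq_zero_or_one_le_of_basis U hU).resolve_right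
      (not_le.mpr ((measure_mono hUV).trans_lt hNV))⟩

theorem IsPointMeasure.one_le_measure_singleton (h : IsPointMeasure N) {x : Space d}
    (hx : x ∈ points N) : 1 ≤ N {x} := by
  by_contra! hlt
  obtain ⟨U, hU, hNU⟩ := h.exists_mem_nhds_measure_eq_zero hlt
  exact hx (measure_mono_null (Set.singleton_subset_iff.mpr (mem_of_mem_nhds hU)) hNU)

theorem IsPointMeasure.exists_mem_points (h : IsPointMeasure N) {B : Set (Space d)}
    (hB : N B ≠ 0) : ∃ x ∈ B, x ∈ points N := by
  by_contra! hno
  refine hB (measure_null_of_locally_null B fun x hx => ?_)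
  have hlt : N {x} < 1 := by
    rw [not_not.mp (hno x hx)]
    exact one_pos
  obtain ⟨U, hU, hNU⟩ := h.exists_mem_nhds_measure_eq_zero hlt
  exact ⟨U, mem_nhdsWithin_of_mem_nhds hU, hNU⟩

theorem IsPointMeasure.eq_zero_or_one_le (h : IsPointMeasure N) (B : Set (Space d)) :
    N B = 0 ∨ 1 ≤ N B := by
  refine or_iff_not_imp_left.mpr fun hB => ?_
  obtain ⟨x, hxB, hx⟩ := h.exists_mem_points hB
  exact (h.one_le_measure_singleton hx).trans
    (measure_mono (Set.singleton_subset_iff.mpr hxB))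

theorem IsPointMeasure.shift (h : IsPointMeasure N) (x : Space d) :
    IsPointMeasure (shift x N) := by
  have := h.isLocallyFiniteMeasure
  exact ⟨inferInstance, fun U _ => shift_apply x N U ▸ h.eq_zero_or_one_le _⟩

theorem IsPointMeasure.finite_points (h : IsPointMeasure N) {B : Set (Space d)}
    (hB : Bornology.IsBounded B) : (points N ∩ B).Finite := by
  have := h.isLocallyFiniteMeasure
  have hfin := Measure.finite_const_le_meas_of_disjoint_iUnion N one_pos
    (As := fun x : ↥(points N ∩ B) => ({x.1} : Set (Space d)))
    (fun x => measurableSet_singleton _)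
    (fun x y hxy => Set.disjoint_singleton.mpr fun hxy' => hxy (Subtype.ext hxy'))
    (ne_top_of_le_ne_top hB.measure_lt_top.ne (measure_mono
      (Set.iUnion_subset fun x => Set.singleton_subset_iff.mpr x.2.2)))
  rw [Set.eq_univ_of_forall (s := {x : ↥(points N ∩ B) | 1 ≤ N {x.1}})
    fun x => h.one_le_measure_singleton x.2.1, Set.finite_univ_iff] at hfin
  exact Set.toFinite _

end PointMeasure

/-! ### Poisson processes and the Mecke formula for void events -/

section Poisson

/-- The probability that a Poisson variable with parameter `t ∈ [0, ∞]` vanishes. -/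
def voidProb (t : ℝ≥0∞) : ℝ≥0∞ := EReal.exp (-(t : EReal))

theorem voidProb_zero : voidProb 0 = 1 := by simp [voidProb]

theorem voidProb_top : voidProb ∞ = 0 := by simp [voidProb]

theorem voidProb_coe (t : ℝ≥0) : voidProb t = ENNReal.ofReal (Real.exp (-t)) := rfl

theorem voidProb_add (s t : ℝ≥0∞) : voidProb (s + t) = voidProb s * voidProb t := by
  rw [voidProb, EReal.coe_ennreal_add, EReal.neg_add (by simp) (by simp), sub_eq_add_neg,
    EReal.exp_add]
  rfl

theorem voidProb_antitone : Antitone voidProb := fun _ _ h =>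
  EReal.exp_monotone (EReal.neg_le_neg_iff.mpr (EReal.coe_ennreal_le_coe_ennreal_iff.mpr h))

theorem measurable_voidProb : Measurable voidProb := voidProb_antitone.measurable

theorem log_voidProb (t : ℝ≥0∞) : ENNReal.log (voidProb t) = -(t : EReal) := EReal.log_exp _

theorem poissonLaw_singleton_zero (t : ℝ≥0∞) : poissonLaw t {0} = voidProb t := by
  rcases eq_or_ne t ∞ with rfl | h
  · simp [poissonLaw, voidProb_top]
  · lift t to ℝ≥0 using h
    have h0 : (fun n : ℕ => (n : ℝ≥0∞)) ⁻¹' {0} = {0} := by ext; simp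
    rw [poissonLaw, if_neg ENNReal.coe_ne_top, Measure.map_apply (by fun_prop) (.singleton 0), h0,
      ENNReal.toNNReal_coe, poissonMeasure_singleton, voidProb_coe]
    simp

theorem poissonLaw_singleton_top {t : ℝ≥0∞} (h : t ≠ ∞) : poissonLaw t {∞} = 0 := by
  rw [poissonLaw, if_neg h, Measure.map_apply (by fun_prop) (.singleton _),
    Set.preimage_singleton_eq_empty.mpr (by simp), measure_empty]

theorem add_one_mul_poissonMeasure_singleton (t : ℝ≥0) (n : ℕ) :
    ((n + 1 : ℕ) : ℝ≥0∞) * poissonMeasure t {n + 1} = t * poissonMeasure t {n} := by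
  rw [poissonMeasure_singleton, poissonMeasure_singleton, ← ENNReal.ofReal_natCast,
    ← ENNReal.ofReal_coe_nnreal, ← ENNReal.ofReal_mul (by positivity),
    ← ENNReal.ofReal_mul (by positivity), Nat.factorial_succ]
  congr 1
  push_cast
  field_simp
  ring

theorem lintegral_poissonLaw (t : ℝ≥0∞) : ∫⁻ x, x ∂poissonLaw t = t := by
  rcases eq_or_ne t ∞ with rfl | h
  · rw [poissonLaw, if_pos rfl]
    exact lintegral_dirac' _ measurable_id
  · lift t to ℝ≥0 using h
    have hsum : ∑' n : ℕ, poissonMeasure t {n} = 1 := by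
      simpa using (lintegral_countable' (μ := poissonMeasure t) 1).symm
    calc ∫⁻ x, x ∂poissonLaw t
        = ∑' n : ℕ, (n : ℝ≥0∞) * poissonMeasure t {n} := by
          rw [poissonLaw, if_neg ENNReal.coe_ne_top,
            lintegral_map (f := fun x => x) measurable_id (by fun_prop), lintegral_countable',
            ENNReal.toNNReal_coe]
      _ = ∑' n : ℕ, ((n + 1 : ℕ) : ℝ≥0∞) * poissonMeasure t {n + 1} := by
          rw [tsum_eq_zero_add' ENNReal.summable, Nat.cast_zero, zero_mul, zero_add]
      _ = t := by
          simp_rw [add_one_mul_poissonMeasure_singleton]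
          rw [ENNReal.tsum_mul_left, hsum, mul_one]

variable {d : ℕ} {μ : Measure (Space d)} {Q : Measure (Measure (Space d))}

theorem measurableSet_void {D : Set (Space d)} (hD : MeasurableSet D) :
    MeasurableSet {N : Measure (Space d) | N D = 0} :=
  Measure.measurable_coe hD (.singleton 0)

namespace IsPoissonProcess

theorem void (hQ : IsPoissonProcess μ Q) {D : Set (Space d)} (hD : MeasurableSet D) :
    Q {N | N D = 0} = voidProb (μ D) := by
  rw [← poissonLaw_singleton_zero, ← hQ.map_count D hD,
    Measure.map_apply (Measure.measurable_coe hD) (.singleton 0)]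
  rfl

theorem lintegral (hQ : IsPoissonProcess μ Q) {B : Set (Space d)} (hB : MeasurableSet B) :
    ∫⁻ N, N B ∂Q = μ B := by
  rw [← lintegral_poissonLaw (μ B), ← hQ.map_count B hB,
    lintegral_map (f := fun x => x) measurable_id (Measure.measurable_coe hB)]

theorem ae_lt_top (hQ : IsPoissonProcess μ Q) {B : Set (Space d)} (hB : MeasurableSet B)
    (hμB : μ B ≠ ∞) : ∀ᵐ N ∂Q, N B < ∞ := by
  have h := poissonLaw_singleton_top hμB
  rw [← hQ.map_count B hB, Measure.map_apply (Measure.measurable_coe hB) (.singleton _)] at h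
  exact (measure_eq_zero_iff_ae_notMem.mp h).mono fun N hN => lt_top_iff_ne_top.mpr hN

theorem ae_isPointMeasure [IsLocallyFiniteMeasure μ] (hQ : IsPoissonProcess μ Q) :
    ∀ᵐ N ∂Q, IsPointMeasure N := by
  let K := CompactExhaustion.choice (Space d)
  have hfin : ∀ᵐ N ∂Q, ∀ n, N (K n) < ∞ := ae_all_iff.mpr fun n =>
    hQ.ae_lt_top (K.isCompact n).measurableSet (K.isCompact n).measure_lt_top.ne
  filter_upwards [hfin, hQ.counting] with N hN hcount
  refine ⟨(isLocallyFiniteMeasure_iff_compactExhaustion K).mpr hN, fun U hU => ?_⟩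
  obtain ⟨n, hn⟩ := hcount U (TopologicalSpace.isOpen_of_mem_countableBasis hU).measurableSet
  rw [hn]
  rcases eq_or_ne n 0 with rfl | h0
  · exact .inl (by simp)
  · exact .inr (by exact_mod_cast Order.one_le_iff_pos.mpr (pos_iff_ne_zero.mpr h0))

theorem indepFun (hQ : IsPoissonProcess μ Q) {B D : Set (Space d)} (hB : MeasurableSet B)
    (hD : MeasurableSet D) (hBD : Disjoint B D) :
    IndepFun (fun N : Measure (Space d) => N B) (fun N => N D) Q := by
  have hmeas : ∀ i, MeasurableSet (![B, D] i) := by simp [Fin.forall_fin_two, hB, hD]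
  have hdisj : Pairwise fun i j => Disjoint (![B, D] i) (![B, D] j) := by
    simp [Pairwise, Fin.forall_fin_two, hBD, hBD.symm]
  simpa using (hQ.indep 2 ![B, D] hmeas hdisj).indepFun Fin.zero_ne_one

theorem setLIntegral_void (hQ : IsPoissonProcess μ Q) {B D : Set (Space d)}
    (hB : MeasurableSet B) (hD : MeasurableSet D) :
    ∫⁻ N in {N | N D = 0}, N B ∂Q = μ (B \ D) * voidProb (μ D) := by
  have hind : Measurable (Set.indicator {(0 : ℝ≥0∞)} (1 : ℝ≥0∞ → ℝ≥0∞)) :=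
    measurable_one.indicator (.singleton 0)
  have hvoid : ∫⁻ N : Measure (Space d), Set.indicator {0} 1 (N D) ∂Q = voidProb (μ D) := by
    rw [← hQ.void hD, ← lintegral_indicator_one (measurableSet_void hD)]
    rfl
  rw [← lintegral_indicator (measurableSet_void hD), ← hvoid, ← hQ.lintegral (hB.diff hD)]
  refine .trans (lintegral_congr fun N => ?_)
    (lintegral_mul_eq_lintegral_mul_lintegral_of_indepFun (Measure.measurable_coe (hB.diff hD))
      (hind.comp (Measure.measurable_coe hD))
      ((hQ.indepFun (hB.diff hD) hD Set.disjoint_sdiff_left).comp measurable_id hind))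
  by_cases hN : N D = 0
  · simp [hN, measure_sdiff_null]
  · simp [hN]

end IsPoissonProcess

end Poisson

section Mecke

variable {d : ℕ} {μ : Measure (Space d)} {Q : Measure (Measure (Space d))}

/-- The products of a void event with a Borel set, a π-system on which the Mecke formula is a
direct consequence of independence. -/
def voidRectangles (d : ℕ) : Set (Set (Measure (Space d) × Space d)) :=
  {R | ∃ D B : Set (Space d), MeasurableSet D ∧ MeasurableSet B ∧ R = {N | N D = 0} ×ˢ B}

theorem isPiSystem_voidRectangles (d : ℕ) : IsPiSystem (voidRectangles d) := by
  rintro _ ⟨D, B, hD, hB, rfl⟩ _ ⟨D', B', hD', hB', rfl⟩ _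
  refine ⟨D ∪ D', B ∩ B', hD.union hD', hB.inter hB', ?_⟩
  rw [Set.prod_inter_prod]
  congr 1
  ext N
  simp [measure_union_null_iff]

theorem generateFrom_voidRectangles_le (d : ℕ) :
    MeasurableSpace.generateFrom (voidRectangles d) ≤
      (inferInstance : MeasurableSpace (Measure (Space d) × Space d)) := by
  refine MeasurableSpace.generateFrom_le ?_
  rintro _ ⟨D, B, hD, hB, rfl⟩
  exact (measurableSet_void hD).prod hB

theorem setOf_sub_mem_eq_iUnion_countableBasis {S : Set (Space d)} (hS : IsOpen S) (x : Space d) :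
    {y | y - x ∈ S} = ⋃ U ∈ TopologicalSpace.countableBasis (Space d),
      ⋃ (_ : x ∈ interior {x | ∀ y ∈ U, y - x ∈ S}), U := by
  ext y
  simp only [Set.mem_ofPred_eq, Set.mem_iUnion, exists_prop]
  refine ⟨fun hy => ?_, fun ⟨U, _, hx, hyU⟩ => interior_subset hx y hyU⟩
  obtain ⟨V, hV, W, hW, hVW⟩ := mem_nhds_prod_iff.mp
    ((hS.preimage continuous_sub).mem_nhds (show (y, x) ∈ _ from hy))
  obtain ⟨U, hU, hyU, hUV⟩ :=
    (TopologicalSpace.isBasis_countableBasis (Space d)).mem_nhds_iff.mp hV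
  have hWS : W ⊆ {x' | ∀ y' ∈ U, y' - x' ∈ S} := fun x' hx' y' hy' =>
    hVW (Set.mk_mem_prod (hUV hy') hx')
  exact ⟨U, hU, mem_interior_iff_mem_nhds.mpr (mem_of_superset hW hWS), hyU⟩

theorem measurableSet_generateFrom_voidRectangles {S : Set (Space d)} (hS : IsOpen S) :
    MeasurableSet[MeasurableSpace.generateFrom (voidRectangles d)]
      {p : Measure (Space d) × Space d | shift p.2 p.1 S = 0} := by
  let W (U : Set (Space d)) : Set (Space d) := interior {x | ∀ y ∈ U, y - x ∈ S}
  have hcompl : {p : Measure (Space d) × Space d | shift p.2 p.1 S = 0}ᶜ =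
      ⋃ U ∈ TopologicalSpace.countableBasis (Space d),
        ({N | N ∅ = 0} ×ˢ W U) \ ({N | N U = 0} ×ˢ W U) := by
    ext ⟨N, x⟩
    simp only [Set.mem_compl_iff, Set.mem_ofPred_eq, shift_apply,
      setOf_sub_mem_eq_iUnion_countableBasis hS x, measure_iUnion_null_iff,
      measure_biUnion_null_iff (TopologicalSpace.countable_countableBasis (Space d)),
      Set.mem_iUnion, Set.mem_sdiff, Set.mem_prod, measure_empty, W]
    grind
  have hW (U : Set (Space d)) : MeasurableSet (W U) := isOpen_interior.measurableSet
  refine .of_compl (hcompl ▸ .biUnion (TopologicalSpace.countable_countableBasis _) fun U hU => ?_)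
  exact .diff (.basic _ ⟨∅, W U, .empty, hW U, rfl⟩)
    (.basic _ ⟨U, W U, (TopologicalSpace.isOpen_of_mem_countableBasis hU).measurableSet, hW U, rfl⟩)

theorem measurable_add_dirac (d : ℕ) :
    Measurable fun p : Measure (Space d) × Space d => p.1 + Measure.dirac p.2 := by
  refine Measure.measurable_of_measurable_coe _ fun B hB => ?_
  exact ((Measure.measurable_coe hB).comp measurable_fst).add
    (((Measure.measurable_coe hB).comp Measure.measurable_dirac).comp measurable_snd)

namespace IsPoissonProcess

theorem mecke_voidRectangle (hQ : IsPoissonProcess μ Q) {B C D : Set (Space d)}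
    (hB : MeasurableSet B) (hC : MeasurableSet C) (hD : MeasurableSet D) :
    ∫⁻ N in {N | N D = 0}, N (B ∩ C) ∂Q =
      ∫⁻ x in C, Q {N | (N + Measure.dirac x, x) ∈ {N | N D = 0} ×ˢ B} ∂μ := by
  have hvoid (x : Space d) : Q {N | (N + Measure.dirac x, x) ∈ {N | N D = 0} ×ˢ B} =
      (B \ D).indicator (fun _ => voidProb (μ D)) x := by
    by_cases hx : x ∈ B \ D
    · rw [Set.indicator_of_mem hx, ← hQ.void hD]
      congr 1
      ext N
      simp [Measure.dirac_apply' _ hD, hx.1, hx.2]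
    · rw [Set.indicator_of_notMem hx, ← measure_empty (μ := Q)]
      congr 1
      ext N
      simpa [Measure.dirac_apply' _ hD] using fun _ hxD hxB => hx ⟨hxB, hxD⟩
  simp_rw [hvoid]
  rw [hQ.setLIntegral_void (hB.inter hC) hD, lintegral_indicator (hB.diff hD), setLIntegral_const,
    Measure.restrict_apply (hB.diff hD), mul_comm, Set.inter_sdiff_right_comm]

theorem mecke_of_generateFrom_voidRectangles [IsLocallyFiniteMeasure μ]
    (hQ : IsPoissonProcess μ Q) {C : Set (Space d)} (hC : MeasurableSet C) (hμC : μ C ≠ ∞)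
    {T : Set (Measure (Space d) × Space d)}
    (hT : MeasurableSet[MeasurableSpace.generateFrom (voidRectangles d)] T) :
    ∫⁻ N, N (C ∩ {x | (N, x) ∈ T}) ∂Q =
      ∫⁻ x in C, Q {N | (N + Measure.dirac x, x) ∈ T} ∂μ := by
  have := hQ.isProbabilityMeasure
  have : IsFiniteMeasure (μ.restrict C) := ⟨by simpa using hμC.lt_top⟩
  have hae : ∀ᵐ N ∂Q, locFinPart N = N := hQ.ae_isPointMeasure.mono fun N hN =>
    have := hN.isLocallyFiniteMeasure
    locFinPart_eq N
  let C₁ := Q ⊗ₘ (locFinKernel (Space d)).restrict hC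
  let C₂ := (Q.prod (μ.restrict C)).map fun p => (p.1 + Measure.dirac p.2, p.2)
  have hC₁ {T} (hT : MeasurableSet T) : C₁ T = ∫⁻ N, N (C ∩ {x | (N, x) ∈ T}) ∂Q := by
    rw [Measure.compProd_apply hT]
    refine lintegral_congr_ae (hae.mono fun N hN => ?_)
    beta_reduce
    rw [Kernel.restrict_apply' _ _ _ (measurable_prodMk_left hT), Set.inter_comm]
    exact congrFun (congrArg DFunLike.coe hN) _
  have hC₂ {T} (hT : MeasurableSet T) :
      C₂ T = ∫⁻ x in C, Q {N | (N + Measure.dirac x, x) ∈ T} ∂μ := by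
    have hmap : Measurable fun p : Measure (Space d) × Space d =>
      (p.1 + Measure.dirac p.2, p.2) := (measurable_add_dirac d).prodMk measurable_snd
    rw [Measure.map_apply hmap hT, Measure.prod_apply_symm (hmap hT)]
    rfl
  have hrect : ∀ R ∈ voidRectangles d, C₁ R = C₂ R := by
    rintro _ ⟨D, B, hD, hB, rfl⟩
    have hR := (measurableSet_void hD).prod hB
    rw [hC₁ hR, hC₂ hR, ← hQ.mecke_voidRectangle hB hC hD, ← lintegral_indicator
      (measurableSet_void hD)]
    refine lintegral_congr fun N => ?_
    by_cases hN : N D = 0 <;> simp [hN, Set.inter_comm]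
  have huniv : C₁ Set.univ = C₂ Set.univ := by
    simpa using hrect ({N | N ∅ = 0} ×ˢ Set.univ) ⟨∅, Set.univ, .empty, .univ, rfl⟩
  have : IsFiniteMeasure C₁ := ⟨by
    rw [huniv, hC₂ .univ]
    simpa using hμC.lt_top⟩
  have hT' := generateFrom_voidRectangles_le d _ hT
  rw [← hC₁ hT', ← hC₂ hT']
  exact ext_on_measurableSpace_of_generate_finite _ (voidRectangles d) hrect
    (generateFrom_voidRectangles_le d) rfl (isPiSystem_voidRectangles d) huniv hT

theorem mecke_void [IsLocallyFiniteMeasure μ] (hQ : IsPoissonProcess μ Q) {C : Set (Space d)}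
    (hC : MeasurableSet C) (hμC : μ C ≠ ∞) {S : Set (Space d)} (hS : IsOpen S) :
    ∫⁻ N, N (C ∩ {x | shift x N S = 0}) ∂Q =
      ∫⁻ x in C, Sᶜ.indicator 1 (0 : Space d) * voidProb (shift x μ S) ∂μ := by
  refine (hQ.mecke_of_generateFrom_voidRectangles hC hμC
    (measurableSet_generateFrom_voidRectangles hS)).trans (lintegral_congr fun x => ?_)
  have hSx : MeasurableSet {y | y - x ∈ S} := (measurable_id.sub_const x) hS.measurableSet
  simp only [shift_apply, Set.mem_ofPred_eq]
  by_cases h0 : (0 : Space d) ∈ S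
  · rw [Set.indicator_of_notMem (not_not.mpr h0), zero_mul, ← measure_empty (μ := Q)]
    congr 1
    ext N
    simp [Measure.dirac_apply' _ hSx, h0]
  · rw [Set.indicator_of_mem h0, Pi.one_apply, one_mul, ← hQ.void hSx]
    congr 1
    ext N
    simp [Measure.dirac_apply' _ hSx, h0]

end IsPoissonProcess

end Mecke

/-! ### Stationary random measures and Cox processes -/

section Stationary

variable {d : ℕ}

theorem abs_sub_apply_le_dist (x y : Space d) (i : Fin d) : |x i - y i| ≤ dist x y := by
  simpa [dist_eq_norm] using PiLp.norm_apply_le (x - y) i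

theorem measurableSet_unitCube (d : ℕ) : MeasurableSet (unitCube d) := by
  rw [unitCube, Set.ofPred_forall]
  exact .iInter fun i => (show Measurable fun y : Space d => y i by fun_prop) measurableSet_Icc

/-- The open cube with centre `x` and side length `s`. -/
def openCube (s : ℝ) (x : Space d) : Set (Space d) :=
  {y | ∀ i, |y i - x i| < s / 2}

theorem isOpen_openCube (s : ℝ) (x : Space d) : IsOpen (openCube s x) := by
  rw [openCube, Set.ofPred_forall]
  exact isOpen_iInter_of_finite fun i => isOpen_lt (by fun_prop) continuous_const

theorem measurable_shift_left (x : Space d) : Measurable (shift x : Measure (Space d) → _) :=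
  Measure.measurable_map _ (measurable_id.sub_const x)

variable {Ω : Type*} [MeasurableSpace Ω] {P : Measure Ω} {M : Ω → Measure (Space d)}

namespace IsStationary

theorem lintegral_shift (hstat : IsStationary P M) (hM : Measurable M) (x : Space d)
    {g : Measure (Space d) → ℝ≥0∞} (hg : Measurable g) :
    ∫⁻ ω, g (shift x (M ω)) ∂P = ∫⁻ ω, g (M ω) ∂P := by
  have hx : Measurable fun ω => shift x (M ω) := (measurable_shift_left x).comp hM
  rw [← lintegral_map hg hM, ← hstat x, lintegral_map hg hx]

theorem ae_forall_shift_mem {ι : Type*} [Countable ι] (hstat : IsStationary P M)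
    (hM : Measurable M) (x : ι → Space d) {T : Set (Measure (Space d))} (hT : MeasurableSet T)
    (h : ∀ᵐ ω ∂P, M ω ∈ T) : ∀ᵐ ω ∂P, ∀ i, shift (x i) (M ω) ∈ T := by
  refine ae_all_iff.mpr fun i => ?_
  have h' : ∀ᵐ μ ∂P.map M, μ ∈ T := (ae_map_iff hM.aemeasurable hT).mpr h
  rw [← hstat (x i)] at h'
  exact (ae_map_iff ((measurable_shift_left _).comp hM).aemeasurable hT).mp h'

theorem ae_isLocallyFiniteMeasure (hstat : IsStationary P M) (hM : Measurable M)
    (hint : ∫⁻ ω, M ω (unitCube d) ∂P ≠ ∞) : ∀ᵐ ω ∂P, IsLocallyFiniteMeasure (M ω) := by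
  have hm := Measure.measurable_coe (measurableSet_unitCube d)
  let q := TopologicalSpace.denseSeq (Space d)
  have hq := hstat.ae_forall_shift_mem hM q (measurableSet_lt hm measurable_const)
    (ae_lt_top (hm.comp hM) hint)
  refine hq.mono fun ω hω => ⟨fun x => ?_⟩
  obtain ⟨n, hn⟩ := (TopologicalSpace.denseRange_denseSeq (Space d)).exists_dist_lt
    (x - WithLp.toLp 2 fun _ => (1 / 2 : ℝ)) (show (0 : ℝ) < 1 / 4 by norm_num)
  refine ⟨Metric.ball x (1 / 4), Metric.ball_mem_nhds x (by norm_num),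
    (measure_mono fun y hy i => ?_).trans_lt ((shift_apply (q n) (M ω) _).symm.trans_lt (hω n))⟩
  have hyx := (abs_sub_apply_le_dist y x i).trans_lt hy
  have hxq := (abs_sub_apply_le_dist _ _ i).trans_lt hn
  simp only [PiLp.sub_apply] at hxq
  rw [abs_lt] at hyx hxq
  change 0 ≤ y i - q n i ∧ y i - q n i ≤ 1
  constructor <;> linarith

theorem palm_univ (hstat : IsStationary P M) (hM : Measurable M)
    (hint : ∫⁻ ω, M ω (unitCube d) ∂P ≠ ∞) :
    palm P M Set.univ = ∫⁻ ω, M ω (unitCube d) ∂P := by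
  rw [CoxPerc.palm_univ hM (hstat.ae_isLocallyFiniteMeasure hM hint),
    ← hstat.lintegral_shift hM (WithLp.toLp 2 fun _ => (1 / 2 : ℝ))
      (Measure.measurable_coe (measurableSet_cube 1 0))]
  refine lintegral_congr fun ω => ?_
  rw [shift_apply]
  congr 1
  ext y
  refine forall_congr' fun i => ?_
  simp only [PiLp.sub_apply, PiLp.zero_apply, abs_le]
  constructor <;> rintro ⟨_, _⟩ <;> constructor <;> linarith

theorem ae_palm_essInf_cube_le (hstat : IsStationary P M) (hM : Measurable M)
    (hint : ∫⁻ ω, M ω (unitCube d) ∂P ≠ ∞) {δ : ℝ} (hδ : 0 < δ) (x : Space d) :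
    ∀ᵐ μ ∂palm P M, essInf (fun ω => M ω (cube (δ / 2) 0)) P ≤ μ (openCube δ x) := by
  have hT {B : Set (Space d)} (hB : MeasurableSet B) : MeasurableSet
      {μ : Measure (Space d) | essInf (fun ω => M ω (cube (δ / 2) 0)) P ≤ μ B} :=
    measurableSet_le measurable_const (Measure.measurable_coe hB)
  let q := TopologicalSpace.denseSeq (Space d)
  have hess : ∀ᵐ ω ∂P, essInf (fun ω => M ω (cube (δ / 2) 0)) P ≤ M ω (cube (δ / 2) 0) :=
    ae_essInf_le
  have hq := hstat.ae_forall_shift_mem hM q (hT (measurableSet_cube _ _)) hess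
  refine ae_palm hM (hstat.ae_isLocallyFiniteMeasure hM hint)
    (hT (isOpen_openCube δ x).measurableSet) (hq.mono fun ω hω => .of_forall fun u => ?_)
  obtain ⟨n, hn⟩ := (TopologicalSpace.denseRange_denseSeq (Space d)).exists_dist_lt
    (u + x) (show 0 < δ / 4 by positivity)
  refine le_trans (Set.mem_ofPred_eq ▸ hω n) ?_
  rw [shift_apply, shift_apply]
  refine measure_mono fun y hy i => ?_
  have hyq := hy i
  have hxq := (abs_sub_apply_le_dist _ _ i).trans_lt hn
  simp only [PiLp.sub_apply, PiLp.add_apply, PiLp.zero_apply, sub_zero] at hxq hyq ⊢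
  rw [abs_lt] at hxq ⊢
  rw [abs_le] at hyq
  constructor <;> linarith

end IsStationary

end Stationary

section Cox

variable {d : ℕ} {μ : Measure (Space d)} {Q : Measure (Measure (Space d))}

theorem lintegral_palmKernel_void [IsLocallyFiniteMeasure μ] (hQ : IsPoissonProcess μ Q)
    {S : Set (Space d)} (hS : IsOpen S) :
    ∫⁻ N, palmKernel d N {N | N S = 0} ∂Q =
      ∫⁻ ν, Sᶜ.indicator 1 (0 : Space d) * voidProb (ν S) ∂palmKernel d μ := by
  have hSm := hS.measurableSet
  have hf : Measurable fun ν : Measure (Space d) =>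
      Sᶜ.indicator 1 (0 : Space d) * voidProb (ν S) :=
    (measurable_voidProb.comp (Measure.measurable_coe hSm)).const_mul _
  rw [lintegral_palmKernel μ hf,
    ← hQ.mecke_void (measurableSet_cube 1 0) (isBounded_cube 1 0).measure_lt_top.ne hS]
  refine lintegral_congr_ae (hQ.ae_isPointMeasure.mono fun N hN => ?_)
  have := hN.isLocallyFiniteMeasure
  have hm : MeasurableSet {x | shift x N S = 0} :=
    measurable_shift N (measurableSet_void hSm)
  beta_reduce
  rw [← lintegral_indicator_one (measurableSet_void hSm),
    lintegral_palmKernel N (measurable_one.indicator (measurableSet_void hSm)), Set.inter_comm,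
    ← Measure.restrict_apply hm, ← lintegral_indicator_one hm]
  rfl

variable {Ω : Type*} [MeasurableSpace Ω] {P : Measure Ω} {M X : Ω → Measure (Space d)}

theorem palm_smul (hM : Measurable M) (h : ∀ᵐ ω ∂P, IsLocallyFiniteMeasure (M ω)) {a : ℝ≥0∞}
    (ha : a ≠ ∞) : (palm P fun ω => a • M ω) = a • (palm P M).map (a • ·) := by
  lift a to ℝ≥0 using ha
  have hsmul : Measurable fun N : Measure (Space d) => (a : ℝ≥0∞) • N :=
    Measure.measurable_of_measurable_coe _ fun B hB => (Measure.measurable_coe hB).const_mul _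
  have h' : ∀ᵐ ω ∂P, IsLocallyFiniteMeasure ((a : ℝ≥0∞) • M ω) := h.mono fun ω _ =>
    (inferInstance : IsLocallyFiniteMeasure (a • M ω))
  have haM : Measurable fun ω => (a : ℝ≥0∞) • M ω := hsmul.comp hM
  refine Measure.ext_of_lintegral _ fun f hf => ?_
  have hfa : Measurable fun N : Measure (Space d) => f ((a : ℝ≥0∞) • N) := hf.comp hsmul
  rw [lintegral_smul_measure, lintegral_map hf hsmul, lintegral_palm haM h' hf,
    lintegral_palm hM h hfa, smul_eq_mul, ← lintegral_const_mul' _ _ ENNReal.coe_ne_top]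
  simp only [Measure.restrict_smul, lintegral_smul_measure, shift, Measure.map_smul, smul_eq_mul]

namespace IsCoxProcess

theorem exists_map_eq_bind [IsProbabilityMeasure P] (hX : IsCoxProcess P M X)
    (hM : Measurable M) : ∃ κ : Kernel (Measure (Space d)) (Measure (Space d)),
      P.map X = (P.map M).bind κ ∧ ∀ᵐ μ ∂P.map M, IsPoissonProcess μ (κ μ) := by
  obtain ⟨κ, hκ, hMX, hpoisson⟩ := hX.conditional
  have := Measure.isProbabilityMeasure_map (μ := P) hM.aemeasurable
  refine ⟨κ, ?_, hpoisson⟩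
  rw [← Measure.snd_compProd, ← hMX, Measure.snd_map_prodMk hM]

theorem ae_isPointMeasure [IsProbabilityMeasure P] (hX : IsCoxProcess P M X) (hM : Measurable M)
    (h : ∀ᵐ ω ∂P, IsLocallyFiniteMeasure (M ω)) : ∀ᵐ ω ∂P, IsPointMeasure (X ω) := by
  obtain ⟨κ, hXκ, hpoisson⟩ := hX.exists_map_eq_bind hM
  refine (ae_map_iff hX.measurable.aemeasurable measurableSet_isPointMeasure).mp ?_
  rw [hXκ]
  refine Measure.ae_comp_of_ae_ae measurableSet_isPointMeasure ?_
  filter_upwards [hpoisson,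
    (ae_map_iff hM.aemeasurable measurableSet_isLocallyFiniteMeasure).mpr h] with μ hμ hloc
  have : IsLocallyFiniteMeasure μ := hloc
  exact hμ.ae_isPointMeasure

theorem palm_void [IsProbabilityMeasure P] (hX : IsCoxProcess P M X) (hM : Measurable M)
    (h : ∀ᵐ ω ∂P, IsLocallyFiniteMeasure (M ω)) {S : Set (Space d)} (hS : IsOpen S) :
    palm P X {N | N S = 0} =
      ∫⁻ μ, Sᶜ.indicator 1 (0 : Space d) * voidProb (μ S) ∂palm P M := by
  obtain ⟨κ, hXκ, hpoisson⟩ := hX.exists_map_eq_bind hM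
  have hvoid := measurableSet_void hS.measurableSet
  have hf : Measurable fun ν : Measure (Space d) =>
      Sᶜ.indicator 1 (0 : Space d) * voidProb (ν S) :=
    (measurable_voidProb.comp (Measure.measurable_coe hS.measurableSet)).const_mul _
  have hX' := (hX.ae_isPointMeasure hM h).mono fun ω hω => hω.isLocallyFiniteMeasure
  rw [palm_eq_bind hX.measurable hX', palm_eq_bind hM h, hXκ,
    Measure.bind_apply hvoid (palmKernel d).aemeasurable,
    Measure.lintegral_bind κ.aemeasurable ((palmKernel d).measurable_coe hvoid).aemeasurable,
    Measure.lintegral_bind (palmKernel d).aemeasurable hf.aemeasurable]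
  refine lintegral_congr_ae ?_
  filter_upwards [hpoisson,
    (ae_map_iff hM.aemeasurable measurableSet_isLocallyFiniteMeasure).mpr h] with μ hμ hloc
  have : IsLocallyFiniteMeasure μ := hloc
  exact lintegral_palmKernel_void hμ hS

end IsCoxProcess

theorem ae_palm_isPointMeasure (hX : Measurable X) (h : ∀ᵐ ω ∂P, IsPointMeasure (X ω)) :
    ∀ᵐ N ∂palm P X, IsPointMeasure N :=
  ae_palm hX (h.mono fun _ hω => hω.isLocallyFiniteMeasure) measurableSet_isPointMeasure
    (h.mono fun _ hω => .of_forall hω.shift)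

theorem ae_palm_zero_mem_points (hX : Measurable X) (h : ∀ᵐ ω ∂P, IsPointMeasure (X ω)) :
    ∀ᵐ N ∂palm P X, (0 : Space d) ∈ points N := by
  refine ae_palm hX (h.mono fun _ hω => hω.isLocallyFiniteMeasure)
    (measurableSet_void (.singleton (0 : Space d))).compl (h.mono fun ω hω => ?_)
  have hnull : X ω (points (X ω))ᶜ = 0 := by
    by_contra hne
    obtain ⟨x, hx, hx'⟩ := hω.exists_mem_points hne
    exact hx hx'
  filter_upwards [measure_eq_zero_iff_ae_notMem.mp hnull] with x hx
  change shift x (X ω) {0} ≠ 0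
  simpa [shift_apply, sub_eq_zero, points] using hx

/-- The properties of the law `Q` of the Palm version of a Cox process with intensity `a • Λ` that
matter for percolation, in terms of the law `L` of the Palm version of `Λ`. -/
structure IsPalmCox (L : Measure (Measure (Space d))) (a : ℝ≥0∞)
    (Q : Measure (Measure (Space d))) : Prop where
  void : ∀ S : Set (Space d), IsOpen S →
    Q {N | N S = 0} = ∫⁻ μ, Sᶜ.indicator 1 (0 : Space d) * voidProb (a * μ S) ∂L
  ae_isPointMeasure : ∀ᵐ N ∂Q, IsPointMeasure N
  ae_zero_mem_points : ∀ᵐ N ∂Q, (0 : Space d) ∈ points N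

theorem IsCoxProcess.isPalmCox [IsProbabilityMeasure P] {a : ℝ≥0∞} (ha₀ : a ≠ 0) (ha : a ≠ ∞)
    (hX : IsCoxProcess P (fun ω => a • M ω) X) (hM : Measurable M)
    (h : ∀ᵐ ω ∂P, IsLocallyFiniteMeasure (M ω)) : IsPalmCox (palm P M) a (a⁻¹ • palm P X) := by
  have hsmul : Measurable fun N : Measure (Space d) => a • N :=
    Measure.measurable_of_measurable_coe _ fun B hB => (Measure.measurable_coe hB).const_mul _
  have haM : Measurable fun ω => a • M ω := hsmul.comp hM
  have haM' : ∀ᵐ ω ∂P, IsLocallyFiniteMeasure (a • M ω) := by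
    lift a to ℝ≥0 using ha
    exact h.mono fun ω _ => (inferInstance : IsLocallyFiniteMeasure (a • M ω))
  have hpoint := hX.ae_isPointMeasure haM haM'
  refine ⟨fun S hS => ?_,
    (ae_palm_isPointMeasure hX.measurable hpoint).filter_mono (Measure.ae_smul_measure_le _),
    (ae_palm_zero_mem_points hX.measurable hpoint).filter_mono (Measure.ae_smul_measure_le _)⟩
  have hf : Measurable fun ν : Measure (Space d) =>
      Sᶜ.indicator 1 (0 : Space d) * voidProb (ν S) :=
    (measurable_voidProb.comp (Measure.measurable_coe hS.measurableSet)).const_mul _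
  rw [Measure.smul_apply, hX.palm_void haM haM' hS, palm_smul hM h ha, lintegral_smul_measure,
    lintegral_map hf hsmul, smul_eq_mul, smul_eq_mul, ← mul_assoc, ENNReal.inv_mul_cancel ha₀ ha,
    one_mul]
  rfl

namespace IsPalmCox

variable {L : Measure (Measure (Space d))} {a : ℝ≥0∞} {Q : Measure (Measure (Space d))}

theorem isProbabilityMeasure [IsProbabilityMeasure L] (h : IsPalmCox L a Q) :
    IsProbabilityMeasure Q where
  measure_univ := by simpa [voidProb_zero] using h.void ∅ isOpen_empty

theorem void_le [IsProbabilityMeasure L] (h : IsPalmCox L a Q) {S : Set (Space d)}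
    (hS : IsOpen S) {c : ℝ≥0∞} (hc : ∀ᵐ μ ∂L, c ≤ μ S) :
    Q {N | N S = 0} ≤ voidProb (a * c) := by
  rw [h.void S hS]
  calc ∫⁻ μ, Sᶜ.indicator 1 (0 : Space d) * voidProb (a * μ S) ∂L
      ≤ ∫⁻ _, voidProb (a * c) ∂L := by
        refine lintegral_mono_ae (hc.mono fun μ hμ => ?_)
        have hle : Sᶜ.indicator 1 (0 : Space d) ≤ (1 : ℝ≥0∞) :=
          Set.indicator_le_self' (by simp) _
        exact (mul_le_of_le_one_left' hle).trans (voidProb_antitone (by gcongr))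
    _ = voidProb (a * c) := by simp

end IsPalmCox

end Cox

/-! ### Clusters and their discretisation -/

section Cover

variable {V α : Type*} [TopologicalSpace α] {adj : V → V → Prop} {S : Set V}

theorem ChainConnected.isPreconnected_biUnion (hS : ChainConnected adj S) {B : V → Set α}
    (hB : ∀ p ∈ S, IsPreconnected (B p)) (hadj : ∀ p q, adj p q → (B p ∩ B q).Nonempty) :
    IsPreconnected (⋃ p ∈ S, B p) :=
  .biUnion_of_reflTransGen hB fun x hx y hy =>
    Relation.ReflTransGen.mono (fun _ _ h => ⟨hadj _ _ h.1, h.2.1⟩) x y (hS x hx y hy)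

theorem chainConnected_cover_of_isPreconnected {T : Set α} (hT : IsPreconnected T) {B : V → Set α}
    (hfin : S.Finite) (hB : ∀ z ∈ S, IsClosed (B z)) (hmeet : ∀ z ∈ S, (T ∩ B z).Nonempty)
    (hcov : T ⊆ ⋃ z ∈ S, B z) (hadj : ∀ z w, (B z ∩ B w).Nonempty → adj z w) :
    ChainConnected adj S := by
  intro z hz z' hz'
  by_contra hno
  set Z : Set V := {w | w ∈ S ∧ ChainIn adj S z w}
  have hclosed : ∀ U ⊆ S, IsClosed (⋃ w ∈ U, B w) := fun U hU =>
    (hfin.subset hU).isClosed_biUnion fun w hw => hB w (hU hw)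
  have hsplit : T ⊆ (⋃ w ∈ Z, B w) ∪ ⋃ w ∈ S \ Z, B w := by
    rwa [← Set.biUnion_union, Set.union_sdiff_cancel fun w hw => hw.1]
  obtain ⟨x, hxT, hx⟩ := hmeet z hz
  obtain ⟨y, hyT, hy⟩ := hmeet z' hz'
  obtain ⟨u, -, hu, hu'⟩ := isPreconnected_closed_iff.mp hT _ _ (hclosed Z fun w hw => hw.1)
    (hclosed (S \ Z) fun w hw => hw.1) hsplit
    ⟨x, hxT, Set.mem_biUnion (show z ∈ Z from ⟨hz, .refl⟩) hx⟩
    ⟨y, hyT, Set.mem_biUnion (show z' ∈ S \ Z from ⟨hz', fun h => hno h.2⟩) hy⟩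
  obtain ⟨w, hw, hwu⟩ := Set.mem_iUnion₂.mp hu
  obtain ⟨v, hv, hvu⟩ := Set.mem_iUnion₂.mp hu'
  exact hv.2 ⟨hv.1, hw.2.tail ⟨hadj w v ⟨u, hwu, hvu⟩, hw.1, hv.1⟩⟩

end Cover

section Cluster

variable {d : ℕ} {r : ℝ} {V : Set (Space d)} {N : Measure (Space d)}

instance (r : ℝ) : Std.Symm fun x y : Space d => dist x y < r :=
  ⟨fun x y h => dist_comm x y ▸ h⟩

/-- The points of `V` that are joined to the origin by a chain of points of `V` with jumps shorter
than `r`. -/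
def cluster (r : ℝ) (V : Set (Space d)) : Set (Space d) :=
  {x | ChainIn (fun a b => dist a b < r) V x 0}

theorem zero_mem_cluster (r : ℝ) (V : Set (Space d)) : 0 ∈ cluster r V := .refl

theorem mem_cluster_of_dist_lt (h0 : 0 ∈ V) {x y : Space d} (hx : x ∈ cluster r V) (hy : y ∈ V)
    (hyx : dist y x < r) : y ∈ cluster r V :=
  .head ⟨hyx, hy, hx.mem h0⟩ hx

theorem isPreconnected_biUnion_cluster {B : Space d → Set (Space d)}
    (hB : ∀ p, IsPreconnected (B p)) (hball : ∀ p, Metric.closedBall p (r / 2) ⊆ B p) :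
    IsPreconnected (⋃ p ∈ cluster r V, B p) := by
  refine (chainConnected_setOf_chainIn (adj := fun a b => dist a b < r) V 0).isPreconnected_biUnion
    (fun p _ => hB p) fun p q hpq => ⟨midpoint ℝ p q, hball p ?_, hball q ?_⟩
  · rw [Metric.mem_closedBall, dist_midpoint_left, Real.norm_ofNat]
    linarith
  · rw [Metric.mem_closedBall, dist_midpoint_right, Real.norm_ofNat]
    linarith

theorem reachable_gilbertGraph (h0 : 0 ∈ V) {x : Space d} (hx : x ∈ cluster r V) :
    ∃ h : x ∈ V, (gilbertGraph r V).Reachable ⟨x, h⟩ ⟨0, h0⟩ := by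
  induction hx using Relation.ReflTransGen.head_induction_on with
  | refl => exact ⟨h0, .refl _⟩
  | @head a b hab _ ih =>
    obtain ⟨hb, hreach⟩ := ih
    refine ⟨hab.2.1, ?_⟩
    rcases eq_or_ne a b with rfl | hne
    · exact hreach
    · have hG : (gilbertGraph r V).Adj ⟨a, hab.2.1⟩ ⟨b, hb⟩ :=
        ⟨fun h => hne (congrArg Subtype.val h), hab.1⟩
      exact hG.reachable.trans hreach

theorem finite_cluster (h0 : 0 ∈ points N) (hN : ¬OriginPercolates r N) :
    (cluster r (points N)).Finite := by
  have hfin : ((gilbertGraph r (points N)).connectedComponentMk ⟨0, h0⟩).supp.Finite := by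
    by_contra h
    exact hN ⟨h0, h⟩
  refine (hfin.image Subtype.val).subset fun x hx => ?_
  obtain ⟨h, hreach⟩ := reachable_gilbertGraph h0 hx
  exact ⟨⟨x, h⟩, SimpleGraph.ConnectedComponent.sound hreach, rfl⟩

theorem IsPointMeasure.not_originPercolates (hN : IsPointMeasure N) {A : Set (Space d)}
    (hA : IsCompact A) (h0A : 0 ∈ A) (hvoid : N (rBoundary r A) = 0) :
    ¬OriginPercolates r N := by
  rintro ⟨h0, hinf⟩
  have mem_of_reachable : ∀ v : points N,
      (gilbertGraph r (points N)).Reachable ⟨0, h0⟩ v → v.1 ∈ A := by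
    intro v hv
    rw [SimpleGraph.reachable_iff_reflTransGen] at hv
    induction hv with
    | refl => exact h0A
    | @tail a b _ hab ih =>
      by_contra hbA
      have hb : b.1 ∈ rBoundary r A :=
        ⟨Metric.mem_thickening_iff.mpr ⟨a.1, ih, dist_comm a.1 b.1 ▸ hab.2⟩, hbA⟩
      exact b.2 (measure_mono_null (Set.singleton_subset_iff.mpr hb) hvoid)
  refine hinf (.of_finite_image ((hN.finite_points hA.isBounded).subset ?_)
    Subtype.val_injective.injOn)
  rintro _ ⟨v, hv, rfl⟩
  exact ⟨v.2, mem_of_reachable v (SimpleGraph.ConnectedComponent.exact hv).symm⟩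

end Cluster

section Cubes

variable {d : ℕ} {r t δ : ℝ} {V : Set (Space d)} {N : Measure (Space d)} {Z : Set (Fin d → ℤ)}

theorem dist_le_of_forall_abs_sub_le {x y : Space d} {s : ℝ} (hs : 0 ≤ s)
    (h : ∀ i, |x i - y i| ≤ s) : dist x y ≤ √d * s := by
  rw [EuclideanSpace.dist_eq]
  refine Real.sqrt_le_iff.mpr ⟨by positivity, ?_⟩
  rw [mul_pow, Real.sq_sqrt (by positivity)]
  calc ∑ i, dist (x i) (y i) ^ 2
      ≤ ∑ _i : Fin d, s ^ 2 :=
        Finset.sum_le_sum fun i _ => pow_le_pow_left₀ dist_nonneg (h i) 2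
    _ = d * s ^ 2 := by simp

theorem isClosed_cube (s : ℝ) (x : Space d) : IsClosed (cube s x) := by
  rw [cube, Set.ofPred_forall]
  exact isClosed_iInter fun i => isClosed_le (by fun_prop) continuous_const

theorem isCompact_cube (s : ℝ) (x : Space d) : IsCompact (cube s x) :=
  Metric.isCompact_of_isClosed_isBounded (isClosed_cube s x) (isBounded_cube s x)

theorem convex_cube (s : ℝ) (x : Space d) : Convex ℝ (cube s x) := by
  rw [cube, Set.ofPred_forall]
  refine convex_iInter fun i => ?_
  exact (convex_closedBall (x i) (s / 2)).linear_preimage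
    (EuclideanSpace.proj (𝕜 := ℝ) i : Space d →L[ℝ] ℝ).toLinearMap

/-- The point of the lattice `δℤ^d` with index `z`. -/
def latticePoint (δ : ℝ) (z : Fin d → ℤ) : Space d := WithLp.toLp 2 fun i => δ * z i

theorem latticePoint_apply (δ : ℝ) (z : Fin d → ℤ) (i : Fin d) :
    latticePoint δ z i = δ * z i := rfl

/-- The index of a lattice point whose cube contains `x`. -/
def nearestSite (δ : ℝ) (x : Space d) : Fin d → ℤ := fun i => round (x i / δ)

theorem mem_cube_nearestSite (hδ : 0 < δ) (x : Space d) :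
    x ∈ cube δ (latticePoint δ (nearestSite δ x)) := by
  intro i
  have hi : x i - latticePoint δ (nearestSite δ x) i = δ * (x i / δ - round (x i / δ)) := by
    rw [latticePoint_apply, nearestSite]
    field_simp
  rw [hi, abs_mul, abs_of_pos hδ]
  linarith [mul_le_mul_of_nonneg_left (abs_sub_round (x i / δ)) hδ.le]

theorem kingAdj_of_mem_cube (hδ : 0 < δ) {z w : Fin d → ℤ}
    (h : (cube δ (latticePoint δ z) ∩ cube δ (latticePoint δ w)).Nonempty) : KingAdj z w := by
  obtain ⟨x, hz, hw⟩ := h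
  intro i
  have hle : δ * |((z i - w i : ℤ) : ℝ)| ≤ δ * 1 := by
    rw [← abs_of_pos hδ, ← abs_mul, abs_of_pos hδ, mul_one]
    push_cast
    rw [mul_sub]
    exact ((abs_sub_le _ (x i) _).trans (add_le_add
      ((abs_sub_comm (δ * (z i : ℝ)) (x i)).trans_le (hz i)) (hw i))).trans_eq (add_halves δ)
  exact_mod_cast le_of_mul_le_mul_left hle hδ

theorem disjoint_openCube (hδ : 0 < δ) {z w : Fin d → ℤ} (hzw : z ≠ w) :
    Disjoint (openCube δ (latticePoint δ z)) (openCube δ (latticePoint δ w)) := by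
  refine Set.disjoint_left.mpr fun y hz hw => hzw (funext fun i => ?_)
  have hlt : δ * |((z i - w i : ℤ) : ℝ)| < δ * 1 := by
    rw [← abs_of_pos hδ, ← abs_mul, abs_of_pos hδ, mul_one]
    push_cast
    rw [mul_sub]
    exact ((abs_sub_le _ (y i) _).trans_lt (add_lt_add
      ((abs_sub_comm (δ * (z i : ℝ)) (y i)).trans_lt (hz i)) (hw i))).trans_eq (add_halves δ)
  have habs : |z i - w i| < 1 := by exact_mod_cast lt_of_mul_lt_mul_left hlt hδ.le
  exact sub_eq_zero.mp (Int.abs_lt_one_iff.mp habs)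

/-- The indices of the lattice points whose cubes meet `T`. -/
def sitesMeeting (δ : ℝ) (T : Set (Space d)) : Set (Fin d → ℤ) :=
  {z | (T ∩ cube δ (latticePoint δ z)).Nonempty}

theorem nearestSite_mem_sitesMeeting (hδ : 0 < δ) {T : Set (Space d)} {x : Space d} (hx : x ∈ T) :
    nearestSite δ x ∈ sitesMeeting δ T := ⟨x, hx, mem_cube_nearestSite hδ x⟩

theorem finite_sitesMeeting (hδ : 0 < δ) {T : Set (Space d)} (hT : Bornology.IsBounded T) :
    (sitesMeeting δ T).Finite := by
  obtain ⟨R, hR⟩ := hT.subset_closedBall (0 : Space d)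
  obtain ⟨n, hn⟩ := exists_nat_ge ((R + δ / 2) / δ)
  refine (Set.finite_Icc (fun _ => -(n : ℤ)) fun _ => (n : ℤ)).subset ?_
  rintro z ⟨y, hyT, hyz⟩
  have hz : ∀ i, |(z i : ℝ)| ≤ n := fun i => by
    have hy : |y i| ≤ R := by
      simpa using (abs_sub_apply_le_dist y 0 i).trans (hR hyT)
    refine le_trans ?_ hn
    have hyz' : |δ * z i - y i| ≤ δ / 2 := (abs_sub_comm _ _).trans_le (hyz i)
    have habs : |δ * (z i : ℝ)| = |(z i : ℝ)| * δ := by rw [abs_mul, abs_of_pos hδ, mul_comm]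
    rw [le_div_iff₀ hδ, ← habs]
    linarith [abs_sub_abs_le_abs_sub (δ * z i) (y i)]
  exact ⟨fun i => by exact_mod_cast (abs_le.mp (hz i)).1,
    fun i => by exact_mod_cast (abs_le.mp (hz i)).2⟩

theorem chainConnected_sitesMeeting (hδ : 0 < δ) {T : Set (Space d)} (hT : IsPreconnected T)
    (hfin : (sitesMeeting δ T).Finite) : ChainConnected KingAdj (sitesMeeting δ T) :=
  chainConnected_cover_of_isPreconnected hT hfin (fun _ _ => isClosed_cube _ _) (fun _ hz => hz)
    (fun _ hx => Set.mem_biUnion (nearestSite_mem_sitesMeeting hδ hx) (mem_cube_nearestSite hδ _))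
    fun _ _ => kingAdj_of_mem_cube hδ

/-- The union of the closed cubes of side `δ` around the lattice points with indices in `Z`. -/
def cubeUnion (δ : ℝ) (Z : Set (Fin d → ℤ)) : Set (Space d) :=
  ⋃ z ∈ Z, cube δ (latticePoint δ z)

theorem isCompact_cubeUnion (δ : ℝ) (hZ : Z.Finite) : IsCompact (cubeUnion δ Z) :=
  hZ.isCompact_biUnion fun _ _ => isCompact_cube _ _

theorem cubeUnion_cluster_mem_rConnected (hr : 0 < r) (hδ : 0 < δ) (hfin : (cluster r V).Finite) :
    cubeUnion δ (nearestSite δ '' cluster r V) ∈ rConnected d r := by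
  have hcompact := isCompact_cubeUnion δ (hfin.image (nearestSite δ))
  have h0 : (0 : Space d) ∈ cubeUnion δ (nearestSite δ '' cluster r V) :=
    Set.mem_biUnion (Set.mem_image_of_mem _ (zero_mem_cluster r V)) (mem_cube_nearestSite hδ 0)
  refine ⟨hcompact, h0, ⟨0, Metric.self_subset_cthickening _ h0⟩, ?_⟩
  have heq : Metric.cthickening (r / 2) (cubeUnion δ (nearestSite δ '' cluster r V)) =
      ⋃ p ∈ cluster r V,
        Metric.cthickening (r / 2) (cube δ (latticePoint δ (nearestSite δ p))) := by
    rw [hcompact.cthickening_eq_biUnion_closedBall (half_pos hr).le]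
    simp only [(isCompact_cube _ _).cthickening_eq_biUnion_closedBall (half_pos hr).le, cubeUnion,
      Set.biUnion_image, Set.biUnion_iUnion]
  rw [heq]
  exact isPreconnected_biUnion_cluster (fun p => ((convex_cube _ _).cthickening _).isPreconnected)
    fun p => Metric.closedBall_subset_cthickening (mem_cube_nearestSite hδ p) _

theorem IsPointMeasure.rBoundary_cubeUnion_cluster (hN : IsPointMeasure N) (h0 : 0 ∈ points N)
    (hδ : 0 < δ) (ht : t + √d * δ ≤ r) :
    N (rBoundary t (cubeUnion δ (nearestSite δ '' cluster r (points N)))) = 0 := by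
  by_contra hne
  obtain ⟨x, ⟨hx, hxU⟩, hxN⟩ := hN.exists_mem_points hne
  obtain ⟨y, hy, hxy⟩ := Metric.mem_thickening_iff.mp hx
  simp only [cubeUnion, Set.biUnion_image, Set.mem_iUnion, exists_prop] at hy
  obtain ⟨p, hp, hyp⟩ := hy
  have hyp' : dist y p ≤ √d * δ := dist_le_of_forall_abs_sub_le hδ.le fun i => by
    have := abs_sub_le (y i) (latticePoint δ (nearestSite δ p) i) (p i)
    linarith [hyp i, mem_cube_nearestSite hδ p i,
      abs_sub_comm (p i) (latticePoint δ (nearestSite δ p) i)]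
  have hxC := mem_cluster_of_dist_lt h0 hp hxN (r := r) (by linarith [dist_triangle x y p])
  exact hxU (Set.mem_biUnion (Set.mem_image_of_mem _ hxC) (mem_cube_nearestSite hδ x))

/-- The event that there is a lattice path visiting at least `n + 1` sites, all with empty open
cubes, that starts on the positive `i₀`-axis, within the number of its steps from the origin. -/
def emptyPathEvent (δ : ℝ) (i₀ : Fin d) (n : ℕ) : Set (Measure (Space d)) :=
  {N | ∃ k, n ≤ k ∧ ∃ a ≤ k, ∃ p : ℕ → Fin d → ℤ, p 0 = Pi.single i₀ (a : ℤ) ∧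
    (∀ j, KingAdj (p j) (p (j + 1))) ∧ Set.InjOn p (Set.Iic k) ∧
    ∀ j, N (openCube δ (latticePoint δ (p j))) = 0}

theorem IsPointMeasure.mem_emptyPathEvent [Nontrivial (Fin d)] (hN : IsPointMeasure N)
    (h0 : 0 ∈ points N) (hr : 0 < r) (hδ : 0 < δ) (hδr : √d * (2 * δ) < r / 2)
    (hfin : (cluster r (points N)).Finite) {q : Space d} (hq : q ∈ cluster r (points N))
    {i : Fin d} {n : ℕ} (hn : 2 * (n : ℤ) ≤ |nearestSite δ q i|) (i₀ : Fin d) :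
    N ∈ emptyPathEvent δ i₀ n := by
  set K := cluster r (points N)
  set T : Set (Space d) := ⋃ p ∈ K, Metric.closedBall p (r / 2)
  have hT : IsPreconnected T := isPreconnected_biUnion_cluster
    (fun p => (convex_closedBall p _).isPreconnected) fun p => subset_rfl
  have hKT : K ⊆ T := fun p hp => Set.mem_biUnion hp (Metric.mem_closedBall_self (half_pos hr).le)
  have hsites := finite_sitesMeeting hδ ((Bornology.isBounded_biUnion hfin).mpr fun p _ =>
    Metric.isBounded_closedBall (x := p) (r := r / 2))
  have h0T : (0 : Fin d → ℤ) ∈ sitesMeeting δ T :=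
    ⟨0, hKT (zero_mem_cluster _ _), fun i => by
      simpa [latticePoint_apply] using (half_pos hδ).le⟩
  obtain ⟨k, hk, a, ha, p, hp0, hpT, hpadj, hpinj⟩ := exists_boundary_path hsites
    (chainConnected_sitesMeeting hδ hT hsites) h0T
    (nearestSite_mem_sitesMeeting hδ (hKT hq)) hn i₀
  refine ⟨k, hk, a, ha, p, hp0, hpadj, hpinj, fun j => ?_⟩
  by_contra hne
  obtain ⟨x, hx, hxN⟩ := hN.exists_mem_points hne
  obtain ⟨hout, c, ⟨y, hyT, hyc⟩, hadj⟩ := hpT j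
  obtain ⟨u, hu, hyu⟩ := Set.mem_iUnion₂.mp hyT
  have hxy : dist x y ≤ √d * (2 * δ) := dist_le_of_forall_abs_sub_le (by positivity) fun i => by
    have hstep : |latticePoint δ (p j) i - latticePoint δ c i| ≤ δ := by
      have : |(c i - p j i : ℝ)| ≤ 1 := by exact_mod_cast hadj i
      rw [latticePoint_apply, latticePoint_apply, ← mul_sub, abs_mul, abs_of_pos hδ, abs_sub_comm]
      exact mul_le_of_le_one_right hδ.le this
    linarith [abs_sub_le (x i) (latticePoint δ (p j) i) (y i), hx i, hyc i,
      abs_sub_le (latticePoint δ (p j) i) (latticePoint δ c i) (y i),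
      abs_sub_comm (y i) (latticePoint δ c i)]
  have hxK : x ∈ K := mem_cluster_of_dist_lt h0 hu hxN
    (by linarith [dist_triangle x y u, Metric.mem_closedBall.mp hyu])
  exact hout ⟨x, hKT hxK, fun i => (hx i).le⟩

/-- The `r`-connected unions of lattice cubes whose indices have coordinates in `[-2 n, 2 n]`. -/
def boxUnions (δ r : ℝ) (n : ℕ) : Set (Set (Space d)) :=
  rConnected d r ∩ cubeUnion δ '' 𝒫 Set.Icc (fun _ => -(2 * n : ℤ)) fun _ => 2 * n

theorem finite_boxUnions (δ r : ℝ) (n : ℕ) : (boxUnions δ r n : Set (Set (Space d))).Finite :=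
  ((Set.finite_Icc _ _).powerset.image _).subset Set.inter_subset_right

theorem IsPointMeasure.exists_isolated_or_emptyPath [Nontrivial (Fin d)] (hN : IsPointMeasure N)
    (h0 : 0 ∈ points N) (hperc : ¬OriginPercolates r N) (hr : 0 < r) (hδ : 0 < δ)
    (ht : t + √d * δ ≤ r) (hδr : √d * (2 * δ) < r / 2) (n : ℕ) (i₀ : Fin d) :
    (∃ A ∈ boxUnions δ r n, N (rBoundary t A) = 0) ∨ N ∈ emptyPathEvent δ i₀ n := by
  have hfin := finite_cluster h0 hperc
  by_cases hfar : ∃ q ∈ cluster r (points N), ∃ i, 2 * (n : ℤ) ≤ |nearestSite δ q i|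
  · obtain ⟨q, hq, i, hi⟩ := hfar
    exact .inr (hN.mem_emptyPathEvent h0 hr hδ hδr hfin hq hi i₀)
  · push Not at hfar
    refine .inl ⟨_, ⟨cubeUnion_cluster_mem_rConnected hr hδ hfin, _, ?_, rfl⟩,
      hN.rBoundary_cubeUnion_cluster h0 hδ ht⟩
    rintro _ ⟨q, hq, rfl⟩
    exact ⟨fun i => (abs_lt.mp (hfar q hq i)).1.le, fun i => (abs_lt.mp (hfar q hq i)).2.le⟩

end Cubes

/-! ### Exponential rates -/

section Asymptotics

theorem voidProb_natCast_mul (n : ℕ) (t : ℝ≥0∞) : voidProb (n * t) = voidProb t ^ n := by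
  induction n with
  | zero => simp [voidProb_zero]
  | succ n ih => rw [Nat.cast_add_one, add_mul, one_mul, voidProb_add, ih, pow_succ]

theorem tendsto_voidProb_ofReal_mul {c : ℝ≥0∞} (hc : c ≠ 0) :
    Tendsto (fun lam : ℝ => voidProb (ENNReal.ofReal lam * c)) atTop (𝓝 0) := by
  have hmul : Tendsto (fun lam : ℝ => ENNReal.ofReal lam * c) atTop (𝓝 (∞ * c)) :=
    ENNReal.Tendsto.mul_const ENNReal.tendsto_ofReal_atTop (.inl ENNReal.top_ne_zero)
  rw [ENNReal.top_mul hc] at hmul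
  have hexp : Continuous voidProb :=
    ENNReal.continuous_exp.comp (continuous_neg.comp continuous_coe_ennreal_ereal)
  simpa only [voidProb_top, Function.comp_def] using (hexp.tendsto ∞).comp hmul

theorem neg_coe_le_of_forall_lt {c : ℝ≥0∞} {x : EReal}
    (h : ∀ K : ℝ≥0, c < K → -((K : ℝ≥0∞) : EReal) ≤ x) : -(c : EReal) ≤ x := by
  rw [EReal.neg_le]
  refine (le_max_right 0 (-x)).trans_eq EReal.coe_toENNReal_eq_max.symm |>.trans ?_
  rw [EReal.coe_ennreal_le_coe_ennreal_iff]
  refine le_of_forall_gt_imp_ge_of_dense fun K hK => ?_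
  cases K with
  | top => exact le_top
  | coe K =>
    exact (EReal.toENNReal_le_toENNReal (EReal.neg_le.mp (h K hK))).trans_eq EReal.toENNReal_coe

theorem le_neg_coe_of_forall_le {c : ℝ≥0∞} {x : EReal}
    (h : ∀ K : ℝ≥0, K ≤ c → x ≤ -((K : ℝ≥0∞) : EReal)) : x ≤ -(c : EReal) := by
  have hx : 0 ≤ -x := by simpa using EReal.le_neg_of_le_neg (h 0 zero_le)
  refine EReal.le_neg_of_le_neg ?_
  rw [← EReal.coe_toENNReal hx, EReal.coe_ennreal_le_coe_ennreal_iff]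
  refine ENNReal.le_of_forall_nnreal_lt fun K hK => ?_
  rw [← EReal.coe_ennreal_le_coe_ennreal_iff, EReal.coe_toENNReal hx]
  exact EReal.le_neg_of_le_neg (h K hK.le)

variable {C : ℝ≥0∞} {u : ℝ → ℝ≥0∞}

theorem tendsto_log_mul_voidProb_div (hC₀ : C ≠ 0) (hC : C ≠ ∞) (K : ℝ≥0) :
    Tendsto (fun lam : ℝ => ENNReal.log (C * voidProb (ENNReal.ofReal lam * K)) / (lam : EReal))
      atTop (𝓝 (-((K : ℝ≥0∞) : EReal))) := by
  have hreal : Tendsto (fun lam : ℝ => Real.log C.toReal / lam - K) atTop (𝓝 (0 - K)) :=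
    (tendsto_const_nhds.div_atTop tendsto_id).sub tendsto_const_nhds
  rw [zero_sub] at hreal
  refine (EReal.tendsto_coe.mpr hreal).congr' ?_
  filter_upwards [eventually_gt_atTop 0] with lam hlam
  rw [ENNReal.log_mul_add, log_voidProb, ENNReal.log_pos_real hC₀ hC, EReal.coe_ennreal_mul,
    EReal.coe_ennreal_ofReal, max_eq_left hlam.le, EReal.coe_nnreal_eq_coe_real]
  have hdiv : Real.log C.toReal / lam - K = (Real.log C.toReal + -(lam * K)) / lam := by
    field_simp
    ring
  rw [hdiv, EReal.coe_div, EReal.coe_add, EReal.coe_neg, EReal.coe_mul]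

theorem limsup_log_div_le (hC₀ : C ≠ 0) (hC : C ≠ ∞) {K : ℝ≥0}
    (hu : ∀ᶠ lam : ℝ in atTop, u lam ≤ C * voidProb (ENNReal.ofReal lam * K)) :
    limsup (fun lam : ℝ => ENNReal.log (u lam) / (lam : EReal)) atTop ≤
      -((K : ℝ≥0∞) : EReal) := by
  rw [← (tendsto_log_mul_voidProb_div hC₀ hC K).limsup_eq]
  refine limsup_le_limsup ?_
  filter_upwards [hu, eventually_ge_atTop 0] with lam hle hlam
  exact EReal.div_le_div_right_of_nonneg (by exact_mod_cast hlam) (ENNReal.log_le_log hle)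

theorem neg_essInf_le_liminf {α : Type*} [MeasurableSpace α] {L : Measure α} [IsFiniteMeasure L]
    {f : α → ℝ≥0∞} (hf : Measurable f)
    (hu : ∀ᶠ lam : ℝ in atTop, ∫⁻ x, voidProb (ENNReal.ofReal lam * f x) ∂L ≤ u lam) :
    -((essInf f L : ℝ≥0∞) : EReal) ≤
      liminf (fun lam : ℝ => ENNReal.log (u lam) / (lam : EReal)) atTop := by
  refine neg_coe_le_of_forall_lt fun K hK => ?_
  have hC₀ : L {x | f x ≤ K} ≠ 0 := fun h0 => hK.not_ge <| le_essInf_of_ae_le _ <|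
    (measure_eq_zero_iff_ae_notMem.mp h0).mono fun x hx => (not_le.mp hx).le
  rw [← (tendsto_log_mul_voidProb_div hC₀ (measure_ne_top _ _) K).liminf_eq]
  refine liminf_le_liminf ?_
  filter_upwards [hu, eventually_ge_atTop 0] with lam hle hlam
  refine EReal.div_le_div_right_of_nonneg (by exact_mod_cast hlam) (ENNReal.log_le_log ?_)
  have hmeas : Measurable fun x => voidProb (ENNReal.ofReal lam * f x) :=
    measurable_voidProb.comp (hf.const_mul _)
  calc L {x | f x ≤ K} * voidProb (ENNReal.ofReal lam * K)
      ≤ voidProb (ENNReal.ofReal lam * K) *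
          L {x | voidProb (ENNReal.ofReal lam * K) ≤ voidProb (ENNReal.ofReal lam * f x)} := by
        rw [mul_comm]
        exact mul_le_mul_right
          (measure_mono fun x hx => voidProb_antitone (mul_le_mul_right hx _)) _
    _ ≤ ∫⁻ x, voidProb (ENNReal.ofReal lam * f x) ∂L := mul_meas_ge_le_lintegral hmeas _
    _ ≤ u lam := hle

end Asymptotics

section Cost

variable {d : ℕ} {s t : ℝ} {A : Set (Space d)}

theorem rConnected_mono (hst : s ≤ t) : rConnected d s ⊆ rConnected d t := by
  rintro A ⟨hA, h0, hc⟩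
  rcases le_or_gt t 0 with ht | ht
  · refine ⟨hA, h0, ?_⟩
    rwa [Metric.cthickening_of_nonpos (by linarith), ← Metric.cthickening_of_nonpos
      (show s / 2 ≤ 0 by linarith)]
  have hsub : Metric.cthickening (s / 2) A ⊆ Metric.cthickening (t / 2) A :=
    Metric.cthickening_mono (by linarith) A
  have hself := Metric.self_subset_cthickening (δ := s / 2) A
  refine ⟨hA, h0, ⟨0, hsub (hself h0)⟩, isPreconnected_of_forall 0 fun y hy => ?_⟩
  rw [hA.cthickening_eq_biUnion_closedBall (half_pos ht).le] at hy
  obtain ⟨a, ha, hya⟩ := Set.mem_iUnion₂.mp hy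
  exact ⟨Metric.cthickening (s / 2) A ∪ Metric.closedBall a (t / 2),
    Set.union_subset hsub (Metric.closedBall_subset_cthickening ha _), .inl (hself h0), .inr hya,
    hc.isPreconnected.union a (hself ha) (Metric.mem_closedBall_self (half_pos ht).le)
      (convex_closedBall a _).isPreconnected⟩

theorem rBoundary_mono (hst : s ≤ t) : rBoundary s A ⊆ rBoundary t A :=
  Set.sdiff_subset_sdiff_left (Metric.thickening_mono hst A)

theorem isOpen_rBoundary (t : ℝ) (hA : IsCompact A) : IsOpen (rBoundary t A) :=
  Metric.isOpen_thickening.sdiff hA.isClosed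

theorem antitone_isolationCost {Ω : Type*} [MeasurableSpace Ω] (P : Measure Ω)
    (M : Ω → Measure (Space d)) (r : ℝ) :
    Antitone fun ε : ℝ => isolationCost P M (r + ε) (r - ε) := by
  refine fun ε ε' h => le_iInf₂ fun A hA =>
    (iInf₂_le A (rConnected_mono (by linarith) hA)).trans ?_
  exact essInf_mono_ae (.of_forall fun μ => measure_mono (rBoundary_mono (by linarith)))

end Cost

/-! ### Bounds on the percolation probability -/

section LatticePaths

variable {d : ℕ}

/-- The lattice path with starting point `z₀` and increments `s`, constant from time `k` on. -/
def latticePath (z₀ : Fin d → ℤ) {k : ℕ} (s : Fin k → Fin d → Finset.Icc (-1 : ℤ) 1) (j : ℕ) :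
    Fin d → ℤ :=
  fun i => z₀ i + ∑ l ∈ Finset.range j, if h : l < k then (s ⟨l, h⟩ i : ℤ) else 0

theorem exists_latticePath_eq (k : ℕ) {p : ℕ → Fin d → ℤ} (hp : ∀ j, KingAdj (p j) (p (j + 1))) :
    ∃ s : Fin k → Fin d → Finset.Icc (-1 : ℤ) 1, ∀ j ≤ k, latticePath (p 0) s j = p j := by
  refine ⟨fun l i => ⟨p (l + 1) i - p l i, Finset.mem_Icc.mpr (abs_le.mp
    ((abs_sub_comm _ _).trans_le (hp l i)))⟩, fun j hj => funext fun i => ?_⟩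
  have hsum : (∑ l ∈ Finset.range j, if _ : l < k then p (l + 1) i - p l i else 0) =
      p j i - p 0 i :=
    (Finset.sum_congr rfl fun l hl => dif_pos ((Finset.mem_range.mp hl).trans_le hj)).trans
      (Finset.sum_range_sub (fun l => p l i) j)
  simp only [latticePath, hsum, add_sub_cancel]

theorem tsum_mul_pow_mul_pow_le {b q : ℝ≥0∞} (hbq : 4 * b * q ≤ 1) (hq : q ≤ 1) (n : ℕ) :
    ∑' m : ℕ, ((n + m + 1 : ℕ) : ℝ≥0∞) * b ^ (n + m) * q ^ (n + m + 1) ≤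
      2 * (2 * b * q) ^ n := by
  have hhalf : 2 * b * q ≤ 2⁻¹ := by
    rw [← one_div, ENNReal.le_div_iff_mul_le (by simp) (by simp)]
    calc 2 * b * q * 2 = 4 * b * q := by ring
      _ ≤ 1 := hbq
  have hterm (m : ℕ) : ((n + m + 1 : ℕ) : ℝ≥0∞) * b ^ (n + m) * q ^ (n + m + 1) ≤
      (2 * b * q) ^ n * 2⁻¹ ^ m := by
    have hcard : ((n + m + 1 : ℕ) : ℝ≥0∞) ≤ 2 ^ (n + m) := by
      exact_mod_cast Nat.lt_two_pow_self (n := n + m)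
    calc ((n + m + 1 : ℕ) : ℝ≥0∞) * b ^ (n + m) * q ^ (n + m + 1)
        ≤ 2 ^ (n + m) * b ^ (n + m) * q ^ (n + m) :=
          mul_le_mul' (mul_le_mul_left hcard _) (pow_le_pow_right_of_le_one' hq (Nat.le_succ _))
      _ = (2 * b * q) ^ n * (2 * b * q) ^ m := by rw [← mul_pow, ← mul_pow, pow_add]
      _ ≤ (2 * b * q) ^ n * 2⁻¹ ^ m := mul_le_mul_right (pow_le_pow_left' hhalf m) _
  calc ∑' m : ℕ, ((n + m + 1 : ℕ) : ℝ≥0∞) * b ^ (n + m) * q ^ (n + m + 1)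
      ≤ ∑' m : ℕ, (2 * b * q) ^ n * 2⁻¹ ^ m := ENNReal.tsum_le_tsum hterm
    _ = 2 * (2 * b * q) ^ n := by
      rw [ENNReal.tsum_mul_left, ENNReal.tsum_geometric, ENNReal.one_sub_inv_two, inv_inv, mul_comm]

end LatticePaths

namespace IsPalmCox

variable {d : ℕ} {L Q : Measure (Measure (Space d))} [IsProbabilityMeasure L] {a c K : ℝ≥0∞}
  {r t δ : ℝ}

theorem lintegral_voidProb_le (h : IsPalmCox L a Q) {A : Set (Space d)} (hA : IsCompact A)
    (h0 : 0 ∈ A) :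
    ∫⁻ μ, voidProb (a * μ (rBoundary r A)) ∂L ≤ 1 - Q {N | OriginPercolates r N} := by
  have := h.isProbabilityMeasure
  have hS := isOpen_rBoundary r hA
  have hperc : Q {N | OriginPercolates r N} ≤ Q {N | N (rBoundary r A) = 0}ᶜ :=
    measure_mono_ae <| h.ae_isPointMeasure.mono fun N hN hNperc hvoid =>
      hN.not_originPercolates hA h0 hvoid hNperc
  have h0' : (0 : Space d) ∈ (rBoundary r A)ᶜ := fun h0S => h0S.2 h0
  calc ∫⁻ μ, voidProb (a * μ (rBoundary r A)) ∂L
      = Q {N | N (rBoundary r A) = 0} := by simp [h.void _ hS, h0']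
    _ = 1 - Q {N | N (rBoundary r A) = 0}ᶜ := by
      rw [prob_compl_eq_one_sub (measurableSet_void hS.measurableSet),
        ENNReal.sub_sub_cancel ENNReal.one_ne_top prob_le_one]
    _ ≤ 1 - Q {N | OriginPercolates r N} := tsub_le_tsub_left hperc 1

theorem measure_exists_isolated_le (h : IsPalmCox L a Q) {𝒜 : Set (Set (Space d))}
    (h𝒜 : 𝒜.Finite) (hcompact : ∀ A ∈ 𝒜, IsCompact A)
    (hK : ∀ A ∈ 𝒜, ∀ᵐ μ ∂L, K ≤ μ (rBoundary t A)) :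
    Q {N | ∃ A ∈ 𝒜, N (rBoundary t A) = 0} ≤ 𝒜.ncard * voidProb (a * K) := by
  have hunion : {N : Measure (Space d) | ∃ A ∈ 𝒜, N (rBoundary t A) = 0} =
      ⋃ A ∈ h𝒜.toFinset, {N | N (rBoundary t A) = 0} := by ext; simp
  rw [hunion, Set.ncard_eq_toFinset_card 𝒜 h𝒜, ← nsmul_eq_mul]
  refine (measure_biUnion_finset_le _ _).trans (Finset.sum_le_card_nsmul _ _ _ fun A hA => ?_)
  rw [Set.Finite.mem_toFinset] at hA
  exact h.void_le (isOpen_rBoundary t (hcompact A hA)) (hK A hA)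

theorem measure_forall_openCube_eq_zero_le (h : IsPalmCox L a Q) (hδ : 0 < δ)
    (hc : ∀ᵐ μ ∂L, ∀ z, c ≤ μ (openCube δ (latticePoint δ z))) (F : Finset (Fin d → ℤ)) :
    Q {N | ∀ z ∈ F, N (openCube δ (latticePoint δ z)) = 0} ≤ voidProb (a * c) ^ F.card := by
  have hvoid : {N : Measure (Space d) | ∀ z ∈ F, N (openCube δ (latticePoint δ z)) = 0} =
      {N | N (⋃ z ∈ F, openCube δ (latticePoint δ z)) = 0} := by
    ext N
    exact (measure_biUnion_null_iff F.countable_toSet).symm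
  rw [hvoid, ← voidProb_natCast_mul, mul_left_comm]
  refine h.void_le (S := ⋃ z ∈ F, openCube δ (latticePoint δ z))
    (isOpen_biUnion fun z _ => isOpen_openCube _ _) (hc.mono fun μ hμ => ?_)
  rw [measure_biUnion_finset (fun z _ w _ hzw => disjoint_openCube hδ hzw)
    fun z _ => (isOpen_openCube _ _).measurableSet, ← nsmul_eq_mul]
  exact Finset.card_nsmul_le_sum _ _ _ fun z _ => hμ z

theorem measure_emptyPathEvent_le_tsum (h : IsPalmCox L a Q) (hδ : 0 < δ)
    (hc : ∀ᵐ μ ∂L, ∀ z, c ≤ μ (openCube δ (latticePoint δ z))) (i₀ : Fin d) (n : ℕ) :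
    Q (emptyPathEvent δ i₀ n) ≤ ∑' m : ℕ, ((n + m + 1 : ℕ) : ℝ≥0∞) * (3 ^ d) ^ (n + m) *
      voidProb (a * c) ^ (n + m + 1) := by
  classical
  let path : {k : ℕ} → Fin (k + 1) × (Fin k → Fin d → Finset.Icc (-1 : ℤ) 1) →
      ℕ → Fin d → ℤ := fun w => latticePath (Pi.single i₀ (w.1 : ℤ)) w.2
  let E : (k : ℕ) → Fin (k + 1) × (Fin k → Fin d → Finset.Icc (-1 : ℤ) 1) →
      Set (Measure (Space d)) := fun k w => {N | Set.InjOn (path w) (Set.Iic k) ∧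
        ∀ z ∈ (Finset.Iic k).image (path w), N (openCube δ (latticePoint δ z)) = 0}
  have hcover : emptyPathEvent δ i₀ n ⊆ ⋃ m, ⋃ w, E (n + m) w := by
    rintro N ⟨k, hk, a, ha, p, hp0, hadj, hinj, hN⟩
    obtain ⟨m, rfl⟩ := Nat.exists_eq_add_of_le hk
    obtain ⟨s, hs⟩ := exists_latticePath_eq (n + m) hadj
    rw [hp0] at hs
    refine Set.mem_iUnion₂.mpr ⟨m, (⟨a, Nat.lt_succ_of_le ha⟩, s),
      hinj.congr fun j hj => (hs j hj).symm, fun z hz => ?_⟩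
    obtain ⟨j, hj, rfl⟩ := Finset.mem_image.mp hz
    exact (congrArg (fun z => N (openCube δ (latticePoint δ z)))
      (hs j (Finset.mem_Iic.mp hj))).trans (hN j)
  have hE (k : ℕ) (w) : Q (E k w) ≤ voidProb (a * c) ^ (k + 1) := by
    by_cases hinj : Set.InjOn (path w) (Set.Iic k)
    · have hcard : ((Finset.Iic k).image (path w)).card = k + 1 := by
        rw [Finset.card_image_of_injOn (by simpa using hinj), Nat.card_Iic]
      rw [← hcard]
      exact (measure_mono fun N hN => hN.2).trans
        (h.measure_forall_openCube_eq_zero_le hδ hc _)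
    · simp [E, hinj]
  calc Q (emptyPathEvent δ i₀ n)
      ≤ ∑' m, ∑ w, Q (E (n + m) w) := (measure_mono hcover).trans <|
        (measure_iUnion_le _).trans (ENNReal.tsum_le_tsum fun m => measure_iUnion_fintype_le _ _)
    _ ≤ ∑' m : ℕ, ((n + m + 1 : ℕ) : ℝ≥0∞) * (3 ^ d) ^ (n + m) *
          voidProb (a * c) ^ (n + m + 1) := by
        refine ENNReal.tsum_le_tsum fun m => (Finset.sum_le_card_nsmul _ _ _ fun w _ =>
          hE (n + m) w).trans_eq ?_
        simp [nsmul_eq_mul]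

theorem measure_emptyPathEvent_le (h : IsPalmCox L a Q) (hδ : 0 < δ)
    (hc : ∀ᵐ μ ∂L, ∀ z, c ≤ μ (openCube δ (latticePoint δ z)))
    (hq : 4 * 3 ^ d * voidProb (a * c) ≤ 1) {n : ℕ} (hn : K ≤ n * c) (i₀ : Fin d) :
    Q (emptyPathEvent δ i₀ n) ≤ 2 * (2 * 3 ^ d) ^ n * voidProb (a * K) := by
  have hq₁ : voidProb (a * c) ≤ 1 := voidProb_zero ▸ voidProb_antitone zero_le
  calc Q (emptyPathEvent δ i₀ n)
      ≤ 2 * (2 * 3 ^ d * voidProb (a * c)) ^ n :=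
        (h.measure_emptyPathEvent_le_tsum hδ hc i₀ n).trans (tsum_mul_pow_mul_pow_le hq hq₁ n)
    _ = 2 * (2 * 3 ^ d) ^ n * voidProb (a * (n * c)) := by
        rw [mul_pow, ← voidProb_natCast_mul, mul_assoc, mul_left_comm (n : ℝ≥0∞)]
    _ ≤ 2 * (2 * 3 ^ d) ^ n * voidProb (a * K) := by
        gcongr
        exact voidProb_antitone (mul_le_mul_right hn a)

theorem one_sub_originPercolates_le [Nontrivial (Fin d)] (h : IsPalmCox L a Q) (hr : 0 < r)
    (hδ : 0 < δ) (ht : t + √d * δ ≤ r) (hδr : √d * (2 * δ) < r / 2) (n : ℕ) (i₀ : Fin d) :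
    1 - Q {N | OriginPercolates r N} ≤
      Q {N | ∃ A ∈ boxUnions δ r n, N (rBoundary t A) = 0} + Q (emptyPathEvent δ i₀ n) := by
  have := h.isProbabilityMeasure
  have hcompl : 1 - Q {N | OriginPercolates r N} ≤ Q {N | OriginPercolates r N}ᶜ := by
    rw [tsub_le_iff_left, ← measure_univ (μ := Q),
      ← Set.union_compl_self {N | OriginPercolates r N}]
    exact measure_union_le _ _
  refine hcompl.trans ((measure_mono_ae ?_).trans (measure_union_le _ _))
  filter_upwards [h.ae_isPointMeasure, h.ae_zero_mem_points] with N hN h0 hperc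
  exact hN.exists_isolated_or_emptyPath h0 hperc hr hδ ht hδr n i₀

end IsPalmCox

section PercolationRates

variable {d : ℕ} {Ω : Type*} [MeasurableSpace Ω] {P : Measure Ω} {M : Ω → Measure (Space d)}
  [IsProbabilityMeasure (palm P M)] {Q : ℝ → Measure (Measure (Space d))} {r : ℝ}

theorem neg_isolationCost_le_liminf
    (hQ : ∀ lam : ℝ, 0 < lam → IsPalmCox (palm P M) (ENNReal.ofReal lam) (Q lam)) :
    -(isolationCost P M r r : EReal) ≤
      liminf (fun lam : ℝ => ENNReal.log (1 - Q lam {N | OriginPercolates r N}) / (lam : EReal))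
        atTop := by
  refine neg_coe_le_of_forall_lt fun K hK => ?_
  simp only [isolationCost, iInf_lt_iff] at hK
  obtain ⟨A, hA, hAK⟩ := hK
  have hrate := neg_essInf_le_liminf (L := palm P M)
    (Measure.measurable_coe (isOpen_rBoundary r hA.1).measurableSet)
    ((eventually_gt_atTop 0).mono fun lam hlam => (hQ lam hlam).lintegral_voidProb_le hA.1 hA.2.1)
  refine le_trans ?_ hrate
  exact EReal.neg_le_neg_iff.mpr (EReal.coe_ennreal_le_coe_ennreal_iff.mpr hAK.le)

theorem exists_mesh (d : ℕ) {ε : ℝ} (hε : 0 < ε) (hr : 0 < r) :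
    ∃ δ : ℝ, 0 < δ ∧ √d * δ ≤ ε ∧ √d * (2 * δ) < r / 2 := by
  have hlim : Tendsto (fun δ : ℝ => √d * δ) (𝓝[>] 0) (𝓝 0) :=
    ((continuous_const_mul √d).tendsto' 0 0 (mul_zero _)).mono_left nhdsWithin_le_nhds
  obtain ⟨δ, ⟨hδε, hδr⟩, hδ⟩ := ((hlim.eventually_lt_const hε).and
    (hlim.eventually_lt_const (show 0 < r / 4 by positivity))).and
      eventually_mem_nhdsWithin |>.exists
  exact ⟨δ, hδ, hδε.le, by linarith⟩

theorem limsup_le_neg_isolationCost [Nontrivial (Fin d)] (hr : 0 < r) {ε : ℝ} (hε : 0 < ε)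
    (hQ : ∀ lam : ℝ, 0 < lam → IsPalmCox (palm P M) (ENNReal.ofReal lam) (Q lam))
    (hcube : ∀ δ : ℝ, 0 < δ → ∃ c ≠ 0, ∀ᵐ μ ∂palm P M, ∀ z,
      c ≤ μ (openCube δ (latticePoint δ z))) :
    limsup (fun lam : ℝ => ENNReal.log (1 - Q lam {N | OriginPercolates r N}) / (lam : EReal))
      atTop ≤ -(isolationCost P M (r + ε) (r - ε) : EReal) := by
  refine le_neg_coe_of_forall_le fun K hK => ?_
  obtain ⟨δ, hδ, hδε, hδr⟩ := exists_mesh d hε hr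
  obtain ⟨c, hc₀, hc⟩ := hcube δ hδ
  obtain ⟨n, hn⟩ := ENNReal.exists_nat_mul_gt hc₀ (ENNReal.coe_ne_top (r := K))
  obtain ⟨i₀⟩ := (inferInstance : Nonempty (Fin d))
  have hpos : (2 * (2 * 3 ^ d) ^ n : ℝ≥0∞) ≠ 0 := by positivity
  refine limsup_log_div_le (C := (boxUnions (d := d) δ r n).ncard + 2 * (2 * 3 ^ d) ^ n)
    (by simp [hpos]) (by finiteness) ?_
  have hsmall : ∀ᶠ lam : ℝ in atTop, 4 * 3 ^ d * voidProb (ENNReal.ofReal lam * c) ≤ 1 := by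
    have hlim := ENNReal.Tendsto.const_mul (a := 4 * 3 ^ d) (tendsto_voidProb_ofReal_mul hc₀)
      (.inr (by finiteness))
    rw [mul_zero] at hlim
    exact hlim.eventually_le_const one_pos
  have hcost (A : Set (Space d)) (hA : A ∈ boxUnions δ r n) :
      ∀ᵐ μ ∂palm P M, (K : ℝ≥0∞) ≤ μ (rBoundary (r - ε) A) :=
    (ae_essInf_le).mono fun _ =>
      (hK.trans (iInf₂_le A (rConnected_mono (by linarith) hA.1))).trans
  filter_upwards [eventually_gt_atTop 0, hsmall] with lam hlam hq
  have h := hQ lam hlam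
  rw [add_mul]
  exact (h.one_sub_originPercolates_le hr hδ (t := r - ε) (by linarith) hδr n i₀).trans <|
    add_le_add (h.measure_exists_isolated_le (finite_boxUnions δ r n) (fun A hA => hA.1.1) hcost)
      (h.measure_emptyPathEvent_le hδ hc hq hn.le i₀)

end PercolationRates

end CoxPerc

end

theorem theorem2p4_general {d : ℕ} {Ω : Type*} [MeasurableSpace Ω] (P : Measure Ω)
    [IsProbabilityMeasure P]
    (Lam : Ω → Measure (CoxPerc.Space d)) (hLam : Measurable Lam)
    (hstat : CoxPerc.IsStationary P Lam)
    (hint : ∫⁻ ω, Lam ω (CoxPerc.unitCube d) ∂P = 1)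
    (X : ℝ → Ω → Measure (CoxPerc.Space d))
    (hX : ∀ lam : ℝ, 0 < lam →
      CoxPerc.IsCoxProcess P (fun ω => ENNReal.ofReal lam • Lam ω) (X lam))
    (r : ℝ) (hr : 0 < r) :
    (-(CoxPerc.isolationCost P Lam r r : EReal) ≤
      liminf (fun lam : ℝ =>
        ENNReal.log (1 - CoxPerc.percProb P (X lam) lam r) / (lam : EReal)) atTop) ∧
    (2 ≤ d →
      (∀ δ : ℝ, 0 < δ → 0 < essInf (fun ω => Lam ω (CoxPerc.cube δ 0)) P) →
      ∃ L : ℝ≥0∞,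
        Tendsto (fun ε : ℝ => CoxPerc.isolationCost P Lam (r + ε) (r - ε)) (𝓝[>] 0) (𝓝 L) ∧
        limsup (fun lam : ℝ =>
          ENNReal.log (1 - CoxPerc.percProb P (X lam) lam r) / (lam : EReal)) atTop ≤
          -(L : EReal)) := by
  have hfin : ∫⁻ ω, Lam ω (CoxPerc.unitCube d) ∂P ≠ ∞ := hint ▸ ENNReal.one_ne_top
  have : IsProbabilityMeasure (CoxPerc.palm P Lam) := ⟨(hstat.palm_univ hLam hfin).trans hint⟩
  have hcox (lam : ℝ) (hlam : 0 < lam) :=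
    (hX lam hlam).isPalmCox (ENNReal.ofReal_pos.mpr hlam).ne' ENNReal.ofReal_ne_top hLam
      (hstat.ae_isLocallyFiniteMeasure hLam hfin)
  refine ⟨CoxPerc.neg_isolationCost_le_liminf hcox, fun hd hess => ?_⟩
  have : Nontrivial (Fin d) := Fin.nontrivial_iff_two_le.mpr hd
  have hlim := (CoxPerc.antitone_isolationCost P Lam r).tendsto_nhdsGT 0
  refine ⟨_, hlim, ?_⟩
  have hneg := ((continuous_neg.comp continuous_coe_ennreal_ereal).tendsto _).comp hlim
  refine ge_of_tendsto hneg (eventually_mem_nhdsWithin.mono fun ε hε =>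
    CoxPerc.limsup_le_neg_isolationCost hr hε hcox fun δ hδ => ?_)
  exact ⟨_, (hess (δ / 2) (half_pos hδ)).ne', ae_all_iff.mpr fun z =>
    hstat.ae_palm_essInf_cube_le hLam hfin hδ (CoxPerc.latticePoint δ z)⟩

theorem theorem2p4 {d : ℕ} {Ω : Type*} [MeasurableSpace Ω] (P : Measure Ω)
    [IsProbabilityMeasure P]
    (Lam : Ω → Measure (CoxPerc.Space d)) (hLam : Measurable Lam)
    (hstat : CoxPerc.IsStationary P Lam)
    (hint : ∫⁻ ω, Lam ω (CoxPerc.unitCube d) ∂P = 1)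
    (X : ℝ → Ω → Measure (CoxPerc.Space d))
    (hX : ∀ lam : ℝ, 0 < lam →
      CoxPerc.IsCoxProcess P (fun ω => ENNReal.ofReal lam • Lam ω) (X lam))
    (r : ℝ) (hr : 0 < r) :
    (-(CoxPerc.isolationCost P Lam r r : EReal) ≤
      liminf (fun lam : ℝ =>
        ENNReal.log (1 - CoxPerc.percProb P (X lam) lam r) / (lam : EReal)) atTop) ∧
    (2 ≤ d → (∃ b : ℝ≥0, CoxPerc.IsBDependent P Lam b) →
      (∀ δ : ℝ, 0 < δ → 0 < essInf (fun ω => Lam ω (CoxPerc.cube δ 0)) P) →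
      ∃ L : ℝ≥0∞,
        Tendsto (fun ε : ℝ => CoxPerc.isolationCost P Lam (r + ε) (r - ε)) (𝓝[>] 0) (𝓝 L) ∧
        limsup (fun lam : ℝ =>
          ENNReal.log (1 - CoxPerc.percProb P (X lam) lam r) / (lam : EReal)) atTop ≤
          -(L : EReal)) :=
  have hgen := theorem2p4_general P Lam hLam hstat hint X hX r hr
  ⟨hgen.1, fun hd _ hess => hgen.2 hd hess⟩
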